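/- **Setting.** Let $S$ be a finite set with at least three elements, with $\Sigma=2^S$, let $\Omega=S^{\infty}$ with states $\omega=(s_1,s_2,\dots)$, let $\mathcal G_t$ be the $\sigma$-algebra on $\Omega$ generated by the first $t$ coordinates and $\mathcal G=\sigma(\bigcup_t\mathcal G_t)$. Let $C$ be a compact metrizable space with at least two elements and let $X$ be the set of Borel probability measures on $C$ with the topology of weak convergence and its Borel $\sigma$-algebra. A consumption plan is a sequence $h=(h_t)_{t\ge 0}$ of $\mathcal G_t$-measurable maps $h_t:\Omega\to X$; $\mathbf H$ is the set of plans and $\mathbf D=X^\infty$ is the set of deterministic plans. For $h\in\mathbf H$, $s\in S$ and $\xi:\Omega\to\mathbb R$ put $h^{s,1}_t(\omega)=h_{t+1}(s,\omega)$, $\xi^{s,1}(\omega)=\xi(s,\omega)$, where $(s,\omega)=(s,s_1,s_2,\dots)$. For $u:X\to\mathbb R$ and $\beta\in(0,1)$ put $U(d)=\sum_{t\ge0}\beta^tu(d_t)$, $d\in\mathbf D$. For a measurable space $(Y,\mathcal A)$ and $K\subseteq\mathbb R$, $B(K,Y,\mathcal A)$ is the set of bounded $\mathcal A$-measurable functions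 $Y\to K$, and $\Delta(Y)$ is the set of finitely additive probabilities on $\mathcal A$. A second-order prior $\mu$ on $Y$ is a countably additive probability on a $\sigma$-algebra of subsets of $\Delta(Y)$ for which every evaluation $p\mapsto p(A)$, $A\in\mathcal A$, is measurable (for instance the Borel $\sigma$-algebra of the topology of weak convergence, i.e. the coarsest topology for which $p\mapsto\int\xi\,dp$ is continuous for every bounded measurable $\xi$). For $\phi:K\to\mathbb R$ continuous and strictly increasing on an interval $K$, the smooth ambiguity functional is $$I^\phi_\mu(\xi)=\phi^{-1}\Big(\int_{\Delta(Y)}\phi\Big(\int_Y\xi\,dp\Big)d\mu(p)\Big),\qquad \xi\in B(K,Y,\mathcal A).$$ The prior $\mu$ is $\phi$-identified if there are a $\sigma$-algebra $\mathcal B\subseteq\mathcal A$ and a countably additive probability $\pi$ on $\mathcal B$ with $\pi(A)\in(0,1)$ for some $A\in\mathcal B$, such that $I^\phi_\mu(\xi)=\phi^{-1}\big(\int\phi(\xi)\,d\pi\big)$ for all $\xi\in B(K,Y,\mathcal B)$. A binary relation $\succsim$ on $\mathbf H$ admits an ex-ante smooth and a recursive smooth representation $(\phi_0,\phi_1,u,\beta,\mu_0,\mu_{+1})$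 if $\beta\in(0,1)$; $u:X\to\mathbb R$ is affine, continuous and non-constant; $\phi_0,\phi_1:U(\mathbf D)\to\mathbb R$ are concave, continuous and strictly increasing; $\mu_0$ and $\mu_{+1}$ are second-order priors on $(\Omega,\mathcal G)$ and on $(S,\Sigma)$; the map $h\mapsto I^{\phi_0}_{\mu_0}\big(\sum_{t\ge0}\beta^tu(h_t)\big)$ represents $\succsim$; some $V:\mathbf H\to U(\mathbf D)$ represents $\succsim$ and satisfies $V(h)=u(h_0)+\beta I^{\phi_1}_{\mu_{+1}}\big(s\mapsto V(h^{s,1})\big)$ for all $h\in\mathbf H$; and generalized rectangularity holds: $I^{\phi_0}_{\mu_0}(\xi)=\beta I^{\phi_1}_{\mu_{+1}}\big(s\mapsto\tfrac1\beta I^{\phi_0}_{\mu_0}(\xi^{s,1})\big)$ for all $\xi\in B(U(\mathbf D),\Omega,\mathcal G)$ such that $\tfrac1\beta I^{\phi_0}_{\mu_0}(\xi^{s,1})\in U(\mathbf D)$ for all $s\in S$. **Corollary.** Suppose that $\succsim$ admits an ex-ante smooth and a recursive smooth representation $(\phi_0,\phi_1,u,\beta,\mu_0,\mu_{+1})$,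 where $I^{\phi_0}_{\mu_0}$ is continuous, i.e. $I^{\phi_0}_{\mu_0}(\xi_n)\to I^{\phi_0}_{\mu_0}(\xi)$ whenever $\xi_n,\xi\in B(U(\mathbf D),\Omega,\mathcal G)$ and $\xi_n\to\xi$ pointwise (this is automatic if $\mu_0$-almost every $p$ is countably additive). If $\mu_0$ is $\phi_0$-identified and $\mu_{+1}$ is $\phi_1$-identified, then $\phi_0$ and $\phi_1$ are, up to positive affine transformations, CARA exponentials: there are $\theta_0,\theta_1\in[0,\infty)$, $a_0,a_1>0$ and $b_0,b_1\in\mathbb R$ with $$\phi_i(t)=a_i\,\phi^{\exp}_{\theta_i}(t)+b_i\qquad\text{for all }t\in U(\mathbf D),\ i=0,1,$$ where $\phi^{\exp}_\theta(t)=-\exp(-\theta t)$ for $\theta>0$ and $\phi^{\exp}_0(t)=t$. -/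

import Mathlib

open MeasureTheory Set Filter Topology

noncomputable section

/-! ### Bounded measurable functions and finitely additive probabilities -/

/-- `B(K, Y, 𝒜)`: the bounded `𝒜`-measurable functions on `Y` with values in `K`. -/
def boundedMeasurable {Y : Type*} (K : Set ℝ) (mY : MeasurableSpace Y) : Set (Y → ℝ) :=
  {ξ | Measurable[mY] ξ ∧ (∀ y, ξ y ∈ K) ∧ ∃ M : ℝ, ∀ y, |ξ y| ≤ M}

/-- `Δ(Y)`: the finitely additive probability measures on the measurable space `Y`. -/
structure FinAddProb (Y : Type*) [MeasurableSpace Y] where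
  toFun : {A : Set Y // MeasurableSet A} → ℝ
  nonneg : ∀ A, 0 ≤ toFun A
  univ_eq : toFun ⟨Set.univ, MeasurableSet.univ⟩ = 1
  union_eq : ∀ (A B : Set Y) (hA : MeasurableSet A) (hB : MeasurableSet B), Disjoint A B →
    toFun ⟨A ∪ B, hA.union hB⟩ = toFun ⟨A, hA⟩ + toFun ⟨B, hB⟩

/-- The integral of a simple function with respect to a finitely additive probability. -/
def FinAddProb.simpleIntegral {Y : Type*} [MeasurableSpace Y] (p : FinAddProb Y)
    (g : SimpleFunc Y ℝ) : ℝ :=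
  ∑ x ∈ g.range, x * p.toFun ⟨g ⁻¹' {x}, g.measurableSet_preimage {x}⟩

/-- The integral `∫ ξ dp` of a bounded measurable function with respect to a finitely additive
probability: the supremum of the integrals of the simple functions below `ξ`. -/
def FinAddProb.integral {Y : Type*} [MeasurableSpace Y] (p : FinAddProb Y) (ξ : Y → ℝ) : ℝ :=
  sSup {r : ℝ | ∃ g : SimpleFunc Y ℝ, (∀ y, g y ≤ ξ y) ∧ r = p.simpleIntegral g}

/-- A second-order prior: a countably additive probability on `Δ(Y)`, defined on a σ-algebra for
which all evaluations `p ↦ p(A)` are measurable. The Borel σ-algebra of the topology of weak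
convergence (the coarsest one for which `p ↦ ∫ ξ dp` is continuous for every bounded measurable
`ξ`) is one such σ-algebra, the σ-algebra generated by the evaluations is the least one. -/
structure SecondOrderPrior (Y : Type*) [MeasurableSpace Y] where
  sigma : MeasurableSpace (FinAddProb Y)
  measurable_eval : ∀ A : {A : Set Y // MeasurableSet A},
    Measurable[sigma] (fun p : FinAddProb Y => p.toFun A)
  measure : @Measure (FinAddProb Y) sigma
  isProb : IsProbabilityMeasure measure

/-! ### Smooth ambiguity functionals -/

/-- `∫ φ(∫ ξ dp) dμ(p)`. -/
def secondOrderUtility {Y : Type*} [MeasurableSpace Y] (φ : ℝ → ℝ) (μ : SecondOrderPrior Y)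
    (ξ : Y → ℝ) : ℝ :=
  @MeasureTheory.integral (FinAddProb Y) ℝ _ _ μ.sigma μ.measure
    (fun p => φ (p.integral ξ))

/-- The smooth ambiguity functional `I^φ_μ(ξ) = φ⁻¹(∫ φ(∫ ξ dp) dμ(p))`, where `φ⁻¹` is the inverse
of `φ` as a function on `K`. -/
def smoothFunctional {Y : Type*} [MeasurableSpace Y] (K : Set ℝ) (φ : ℝ → ℝ)
    (μ : SecondOrderPrior Y) (ξ : Y → ℝ) : ℝ :=
  Function.invFunOn φ K (secondOrderUtility φ μ ξ)

/-- `I : B(K, Y, 𝒜) → ℝ` is continuous: `I(ξₙ) → I(ξ)` whenever `ξₙ → ξ` pointwise. -/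
def ContinuousFunctional {Y : Type*} [mY : MeasurableSpace Y] (K : Set ℝ)
    (I : (Y → ℝ) → ℝ) : Prop :=
  ∀ (ξs : ℕ → Y → ℝ) (ξ : Y → ℝ), (∀ n, ξs n ∈ boundedMeasurable K mY) →
    ξ ∈ boundedMeasurable K mY → (∀ y, Tendsto (fun n => ξs n y) atTop (𝓝 (ξ y))) →
    Tendsto (fun n => I (ξs n)) atTop (𝓝 (I ξ))

/-- Some event has probability strictly between `0` and `1`. -/
def HasNontrivialEvent {Y : Type*} [MeasurableSpace Y] (π : Measure Y) : Prop :=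
  ∃ A : Set Y, MeasurableSet A ∧ 0 < π A ∧ π A < 1

/-- `μ` is `φ`-identified (`φ` being a function on `K`). -/
def IsIdentified {Y : Type*} [mY : MeasurableSpace Y] (K : Set ℝ) (φ : ℝ → ℝ)
    (μ : SecondOrderPrior Y) : Prop :=
  ∃ (mB : MeasurableSpace Y) (_ : mB ≤ mY) (π : @Measure Y mB),
    @IsProbabilityMeasure Y mB π ∧ @HasNontrivialEvent Y mB π ∧
    ∀ ξ ∈ boundedMeasurable K mB,
      @smoothFunctional Y mY K φ μ ξ =
        Function.invFunOn φ K (@MeasureTheory.integral Y ℝ _ _ mB π (fun y => φ (ξ y)))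

/-- The function `φ_θ^exp`, for `θ ≥ 0`. -/
def caraExp (θ t : ℝ) : ℝ := if 0 < θ then -Real.exp (-θ * t) else t

/-! ### States and information -/

/-- The information available in period `t`: the σ-algebra on `Ω = S^∞` generated by the first `t`
coordinates. A state `ω = (s₁, s₂, …)` is the sequence with `ω i = s_{i+1}`. -/
abbrev info (S : Type*) [MeasurableSpace S] (t : ℕ) : MeasurableSpace (ℕ → S) :=
  MeasurableSpace.comap (fun (ω : ℕ → S) (i : Fin t) => ω i) MeasurableSpace.pi

/-- The σ-algebra generated by the filtration is the product σ-algebra on `Ω`. -/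
theorem iSup_info (S : Type*) [MeasurableSpace S] :
    ⨆ t, info S t = (MeasurableSpace.pi : MeasurableSpace (ℕ → S)) := by
  apply le_antisymm
  · refine iSup_le fun t => ?_
    rw [info, ← measurable_iff_comap_le]
    exact measurable_pi_lambda _ fun i => measurable_pi_apply _
  · rw [MeasurableSpace.pi]
    refine iSup_le fun n => le_trans ?_ (le_iSup _ (n + 1))
    rw [← measurable_iff_comap_le]
    have h : Measurable[info S (n + 1)] (fun (ω : ℕ → S) (i : Fin (n + 1)) => ω i) :=
      comap_measurable _
    exact (measurable_pi_apply (Fin.last n)).comp h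

/-- The state `(s, s₁, s₂, …)`. -/
def prepend {S : Type*} (s : S) (ω : ℕ → S) : ℕ → S
  | 0 => s
  | n + 1 => ω n

theorem measurable_prepend_info {S : Type*} [MeasurableSpace S] (s : S) (t : ℕ) :
    Measurable[info S t, info S (t + 1)] (prepend s) := by
  have h : Measurable[info S t] (fun (ω : ℕ → S) (i : Fin t) => ω i) := comap_measurable _
  have h2 : Measurable (fun (v : Fin t → S) (i : Fin (t + 1)) => (Fin.cons s v : Fin (t + 1) → S) i) :=
    measurable_pi_lambda _ fun i => by
      refine Fin.cases ?_ (fun j => ?_) i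
      · exact measurable_const
      · exact measurable_pi_apply j
  have h3 : (fun (ω : ℕ → S) (i : Fin (t + 1)) => ω i) ∘ prepend s =
      (fun (v : Fin t → S) (i : Fin (t + 1)) => (Fin.cons s v : Fin (t + 1) → S) i) ∘
        (fun (ω : ℕ → S) (i : Fin t) => ω i) := by
    funext ω i
    refine Fin.cases ?_ (fun j => ?_) i <;> rfl
  refine (@measurable_comap_iff _ _ _ (info S t) _ _ _).2 ?_
  rw [h3]
  exact h2.comp h

/-- `ξ^{s,1}`: the variable `ξ` shifted one period ahead, given that `s` realizes first. -/
def shiftVar {S : Type*} (ξ : (ℕ → S) → ℝ) (s : S) : (ℕ → S) → ℝ := fun ω => ξ (prepend s ω)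

/-! ### Lotteries and consumption plans -/

/-- The lottery `α x + (1 - α) y`. -/
def lotteryMix {C : Type*} [MeasurableSpace C] (α : unitInterval) (x y : ProbabilityMeasure C) :
    ProbabilityMeasure C :=
  ⟨ENNReal.ofReal α • (x : Measure C) + ENNReal.ofReal (1 - α) • (y : Measure C), ⟨by
    simp only [Measure.add_apply, Measure.smul_apply, measure_univ, smul_eq_mul, mul_one]
    rw [← ENNReal.ofReal_add α.2.1 (sub_nonneg.2 α.2.2)]
    simp⟩⟩

/-- Consumption plans: sequences `h = (h₀, h₁, …)` of lottery-valued maps on `Ω`, with `h_t`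
measurable with respect to the information of period `t` (lotteries carry the topology of weak
convergence and its Borel σ-algebra). -/
structure Plan (S C : Type*) [MeasurableSpace S] [TopologicalSpace C] [MeasurableSpace C]
    [OpensMeasurableSpace C] where
  toFun : ℕ → (ℕ → S) → ProbabilityMeasure C
  adapted : ∀ t, @Measurable _ _ (info S t) (borel (ProbabilityMeasure C)) (toFun t)

variable {S C : Type*} [MeasurableSpace S] [TopologicalSpace C] [MeasurableSpace C]
  [OpensMeasurableSpace C]

/-- The continuation `h^{s,1}` of the plan `h` after the first state `s`. -/
def Plan.continuation (h : Plan S C) (s : S) : Plan S C where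
  toFun t ω := h.toFun (t + 1) (prepend s ω)
  adapted t := @Measurable.comp _ _ _ (info S t) (info S (t + 1))
    (borel (ProbabilityMeasure C)) _ _ (h.adapted (t + 1)) (measurable_prepend_info s t)

/-- `U(d) = ∑ β^t u(d_t)` for a deterministic consumption plan `d`. -/
def lifetimeUtility (u : ProbabilityMeasure C → ℝ) (β : ℝ) (d : ℕ → ProbabilityMeasure C) : ℝ :=
  ∑' t, β ^ t * u (d t)

/-- `U(𝐃)`: the set of the lifetime utilities of all deterministic consumption plans. -/
def utilityRange (u : ProbabilityMeasure C → ℝ) (β : ℝ) : Set ℝ :=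
  Set.range (lifetimeUtility u β)

/-- The random lifetime utility `∑ β^t u(h_t)` of a consumption plan. -/
def Plan.utility (u : ProbabilityMeasure C → ℝ) (β : ℝ) (h : Plan S C) : (ℕ → S) → ℝ :=
  fun ω => lifetimeUtility u β (fun t => h.toFun t ω)

/-- `V` represents the binary relation `pref`. -/
def Represents {H : Type*} (V : H → ℝ) (pref : H → H → Prop) : Prop :=
  ∀ h g, pref h g ↔ V g ≤ V h

/-- The binary relation `pref` on consumption plans admits an ex-ante smooth and a recursive smooth
representation `(φ₀, φ₁, u, β, μ₀, μ₁)`. -/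
structure SmoothRepresentations (pref : Plan S C → Plan S C → Prop) (φ₀ φ₁ : ℝ → ℝ)
    (u : ProbabilityMeasure C → ℝ) (β : ℝ) (μ₀ : SecondOrderPrior (ℕ → S))
    (μ₁ : SecondOrderPrior S) : Prop where
  beta_mem : β ∈ Set.Ioo (0 : ℝ) 1
  u_continuous : Continuous u
  u_affine : ∀ (α : unitInterval) (x y : ProbabilityMeasure C),
    u (lotteryMix α x y) = α * u x + (1 - α) * u y
  u_nonconstant : ∃ x y, u x ≠ u y
  concave₀ : ConcaveOn ℝ (utilityRange u β) φ₀
  continuous₀ : ContinuousOn φ₀ (utilityRange u β)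
  strictMono₀ : StrictMonoOn φ₀ (utilityRange u β)
  concave₁ : ConcaveOn ℝ (utilityRange u β) φ₁
  continuous₁ : ContinuousOn φ₁ (utilityRange u β)
  strictMono₁ : StrictMonoOn φ₁ (utilityRange u β)
  /-- The ex-ante smooth representation. -/
  exAnte : Represents (fun h => smoothFunctional (utilityRange u β) φ₀ μ₀ (h.utility u β)) pref
  /-- The recursive smooth representation; `V` has its values in `U(𝐃)`, since `V ∘ h^1` has to lie
  in the domain of the one-step-ahead functional. (`h 0` is a constant function of `ω`.) -/
  recursive : ∃ V : Plan S C → ℝ, (∀ h, V h ∈ utilityRange u β) ∧ Represents V pref ∧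
    ∀ (h : Plan S C) (ω : ℕ → S), V h = u (h.toFun 0 ω) +
      β * smoothFunctional (utilityRange u β) φ₁ μ₁ (fun s => V (h.continuation s))
  /-- Generalized rectangularity, for all `ξ` for which the right-hand side is defined. -/
  rectangular : ∀ ξ ∈ boundedMeasurable (utilityRange u β) MeasurableSpace.pi,
    (∀ s, 1 / β * smoothFunctional (utilityRange u β) φ₀ μ₀ (shiftVar ξ s) ∈ utilityRange u β) →
    smoothFunctional (utilityRange u β) φ₀ μ₀ ξ =
      β * smoothFunctional (utilityRange u β) φ₁ μ₁
        (fun s => 1 / β * smoothFunctional (utilityRange u β) φ₀ μ₀ (shiftVar ξ s))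

end

/-! Both representations equal lifetime utility on deterministic plans once normalized, so they are
one function of plans (`SmoothRepresentations.exists_common_value`). In the recursive formula
present consumption enters additively and does not affect continuations. Hence raising it by `τ`
utils raises the value by `τ`, and the two smooth functionals commute with adding constants, at
least on acts with two values near an interior payoff (`locallyTranslationInvariant_zero`, for
events known after finitely many periods, and `locallyTranslationInvariant_one`).

On such an act the functional is a certainty equivalent of `y + q * (x - y)` for a random weight
`q`. If `q` is not almost surely constant, translation invariance says that `φ` and `φ (· + τ)` have
locally the same certainty equivalents. A maximum principle (`nonpos_of_local_mean_value`) makes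
them affinely related, and a continuous, increasing, concave index related in this way to all its
small translates is CARA (`exists_caraExp_of_translation`).

A nondegenerate `q` has two sources: the indicator of a nontrivial identified event under `π`, or
the ambiguous probability `p(E)` under the second-order prior. The first settles `φ₁`. For `φ₀` the
identified event may depend on infinitely many periods, where invariance is not known. If some
finite-horizon event is ambiguous, the second source applies. Otherwise continuity makes every event
unambiguous (`ae_const_of_generateFrom`), the functional is affine on binary acts, invariance holds
for all events, and the first source applies. -/

noncomputable section

/-! ### Indices with locally equal certainty equivalents -/

theorem integrable_comp_of_mem_Icc {Ω : Type*} [MeasurableSpace Ω] (P : Measure Ω)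
    [IsFiniteMeasure P] {φ : ℝ → ℝ} {a b : ℝ} (hφ : ContinuousOn φ (Icc a b))
    {Z : Ω → ℝ} (hZ : Measurable Z) (hmem : ∀ ω, Z ω ∈ Icc a b) :
    Integrable (fun ω => φ (Z ω)) P := by
  rcases isEmpty_or_nonempty Ω with hΩ | ⟨⟨ω₀⟩⟩
  · rw [Measure.eq_zero_of_isEmpty P]
    exact integrable_zero_measure
  have hab : a ≤ b := (hmem ω₀).1.trans (hmem ω₀).2
  have hcont : Continuous (IccExtend hab ((Icc a b).domRestrict φ)) :=
    (continuousOn_iff_continuous_domRestrict.1 hφ).Icc_extend'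
  have heq : (fun ω => φ (Z ω)) = fun ω => IccExtend hab ((Icc a b).domRestrict φ) (Z ω) := by
    funext ω
    rw [IccExtend_of_mem hab _ (hmem ω)]
    rfl
  obtain ⟨B, hB⟩ := isCompact_Icc.exists_bound_of_continuousOn hφ
  refine Integrable.of_bound (C := B) ?_ (Eventually.of_forall fun ω => hB _ (hmem ω))
  rw [heq]
  exact (hcont.measurable.comp hZ).aestronglyMeasurable

theorem add_mul_sub_mem_Icc {a b x y q : ℝ} (hx : x ∈ Icc a b) (hy : y ∈ Icc a b)
    (h₀ : 0 ≤ q) (h₁ : q ≤ 1) : y + q * (x - y) ∈ Icc a b := by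
  have h := (convex_Icc a b) hy hx (sub_nonneg.2 h₁) h₀ (by ring)
  simp only [smul_eq_mul] at h
  convert h using 1
  ring

/-- The certainty equivalent of a random variable with values in an interval exists. -/
theorem exists_integral_comp_eq {Ω : Type*} [MeasurableSpace Ω] (P : Measure Ω)
    [IsProbabilityMeasure P] {φ : ℝ → ℝ} {a b : ℝ} (hφ : ContinuousOn φ (Icc a b))
    (hmono : StrictMonoOn φ (Icc a b))
    {Z : Ω → ℝ} (hZ : Measurable Z) (hmem : ∀ ω, Z ω ∈ Icc a b) :
    ∃ z ∈ Icc a b, φ z = ∫ ω, φ (Z ω) ∂P := by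
  have hne : Nonempty Ω := P.nonempty_of_neZero
  obtain ⟨ω₀⟩ := hne
  have hab : a ≤ b := (hmem ω₀).1.trans (hmem ω₀).2
  have hint := integrable_comp_of_mem_Icc P hφ hZ hmem
  have h1 : φ a ≤ ∫ ω, φ (Z ω) ∂P := by
    have := integral_mono (μ := P) (integrable_const (φ a)) hint
      (fun ω => hmono.monotoneOn (left_mem_Icc.2 hab) (hmem ω) (hmem ω).1)
    simpa using this
  have h2 : ∫ ω, φ (Z ω) ∂P ≤ φ b := by
    have := integral_mono (μ := P) hint (integrable_const (φ b))
      (fun ω => hmono.monotoneOn (hmem ω) (right_mem_Icc.2 hab) (hmem ω).2)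
    simpa using this
  exact intermediate_value_Icc hab hφ ⟨h1, h2⟩

/-- A maximum principle. At a positive maximum of `h`, take a small spread whose `f`-certainty
equivalent is the maximizer. The mean value property forces the spread to live on maximizers, and
choosing the leftmost maximizer then forces the spread to be degenerate. -/
theorem nonpos_of_local_mean_value {Ω : Type*} [MeasurableSpace Ω] (P : Measure Ω)
    [IsProbabilityMeasure P] {q : Ω → ℝ} (hq : Measurable q) (hq₀ : ∀ ω, 0 ≤ q ω)
    (hq₁ : ∀ ω, q ω ≤ 1) (hqc : ¬ ∃ c : ℝ, ∀ᵐ ω ∂P, q ω = c)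
    {f h : ℝ → ℝ} {a b : ℝ} (hf : ContinuousOn f (Icc a b)) (hfm : StrictMonoOn f (Icc a b))
    (hh : ContinuousOn h (Icc a b)) (hha : h a = 0) (hhb : h b = 0)
    (H : ∀ v ∈ Ioo a b, ∃ ε > 0, ∀ x ∈ Icc (v - ε) v, ∀ y ∈ Icc v (v + ε), a ≤ x → y ≤ b →
      ∫ ω, f (y + q ω * (x - y)) ∂P = f v → ∫ ω, h (y + q ω * (x - y)) ∂P = h v) :
    ∀ t ∈ Icc a b, h t ≤ 0 := by
  intro t ht
  by_contra! hpos
  obtain ⟨w, hw, hmax⟩ := isCompact_Icc.exists_isMaxOn ⟨t, ht⟩ hh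
  have hmax' : ∀ z ∈ Icc a b, h z ≤ h w := fun z hz => hmax hz
  have hwpos : 0 < h w := hpos.trans_le (hmax' t ht)
  have hclosed : IsCompact (Icc a b ∩ h ⁻¹' {h w}) :=
    isCompact_Icc.of_isClosed_subset (hh.preimage_isClosed_of_isClosed isClosed_Icc isClosed_singleton)
      inter_subset_left
  obtain ⟨v, ⟨hv, hvw⟩, hleast⟩ := hclosed.exists_isLeast ⟨w, hw, rfl⟩
  have hvw : h v = h w := hvw
  have hva : a < v := lt_of_le_of_ne hv.1 (by rintro rfl; linarith)
  have hvb : v < b := lt_of_le_of_ne hv.2 (by rintro rfl; linarith)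
  obtain ⟨ε, hε, Hε⟩ := H v ⟨hva, hvb⟩
  set δ := min ε (min (v - a) (b - v)) with hδ
  have hδpos : 0 < δ := lt_min hε (lt_min (by linarith) (by linarith))
  have hδε : δ ≤ ε := min_le_left _ _
  have hδa : δ ≤ v - a := (min_le_right _ _).trans (min_le_left _ _)
  have hδb : δ ≤ b - v := (min_le_right _ _).trans (min_le_right _ _)
  have hab : a ≤ b := hva.le.trans hvb.le
  -- Dominated convergence below needs an integrand defined for every real `s`, so `f` is extended
  -- by constants; for `s` in `[0, δ]` the extension is not felt.
  set f' := IccExtend hab ((Icc a b).domRestrict f) with hf'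
  have hf'c : Continuous f' := (continuousOn_iff_continuous_domRestrict.1 hf).Icc_extend'
  have hf'eq : ∀ z ∈ Icc a b, f' z = f z := fun z hz => by
    rw [hf', IccExtend_of_mem hab _ hz]; rfl
  have hf'b : ∀ z, ‖f' z‖ ≤ max |f a| |f b| := fun z => by
    have hz := (projIcc a b hab z).2
    have e : f' z = f (projIcc a b hab z) := rfl
    rw [e, Real.norm_eq_abs]
    exact abs_le_max_abs_abs (hfm.monotoneOn (left_mem_Icc.2 hab) hz hz.1)
      (hfm.monotoneOn hz (right_mem_Icc.2 hab) hz.2)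
  -- The window `[v + s - δ, v + s]` slides from below `v` at `s = 0` to above `v` at `s = δ`; in
  -- between, some `s` makes the `f`-mean of the spread equal to `f v`.
  have hFc : Continuous fun s : ℝ => ∫ ω, f' (v + s + q ω * (-δ)) ∂P := by
    refine continuous_of_dominated (bound := fun _ => max |f a| |f b|) ?_ ?_ (integrable_const _) ?_
    · intro s
      exact (hf'c.measurable.comp (by fun_prop)).aestronglyMeasurable
    · exact fun s => Eventually.of_forall fun ω => hf'b _
    · exact Eventually.of_forall fun ω => hf'c.comp (by fun_prop)
  have hqmem : ∀ s ∈ Icc 0 δ, ∀ ω, v + s + q ω * (-δ) ∈ Icc a b := fun s hs ω =>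
    ⟨by nlinarith [hs.1, hq₁ ω], by nlinarith [hs.2, hq₀ ω]⟩
  have hmeas : ∀ s : ℝ, Measurable fun ω => v + s + q ω * (-δ) := fun s => by fun_prop
  have hFint : ∀ s ∈ Icc 0 δ,
      ∫ ω, f' (v + s + q ω * (-δ)) ∂P = ∫ ω, f (v + s + q ω * (-δ)) ∂P := fun s hs =>
    integral_congr_ae (Eventually.of_forall fun ω => hf'eq _ (hqmem s hs ω))
  have h0 : ∫ ω, f' (v + 0 + q ω * (-δ)) ∂P ≤ f v := by
    rw [hFint 0 ⟨le_rfl, hδpos.le⟩]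
    have := integral_mono (μ := P)
      (integrable_comp_of_mem_Icc P hf (hmeas 0) (hqmem 0 ⟨le_rfl, hδpos.le⟩))
      (integrable_const (f v))
      (fun ω => hfm.monotoneOn (hqmem 0 ⟨le_rfl, hδpos.le⟩ ω) hv (by nlinarith [hq₀ ω]))
    simpa using this
  have h1 : f v ≤ ∫ ω, f' (v + δ + q ω * (-δ)) ∂P := by
    rw [hFint δ ⟨hδpos.le, le_rfl⟩]
    have := integral_mono (μ := P) (integrable_const (f v))
      (integrable_comp_of_mem_Icc P hf (hmeas δ) (hqmem δ ⟨hδpos.le, le_rfl⟩))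
      (fun ω => hfm.monotoneOn hv (hqmem δ ⟨hδpos.le, le_rfl⟩ ω) (by nlinarith [hq₁ ω]))
    simpa using this
  obtain ⟨s, hs, hsv⟩ := intermediate_value_Icc hδpos.le hFc.continuousOn ⟨h0, h1⟩
  have hsv : ∫ ω, f (v + s + q ω * (-δ)) ∂P = f v := by rw [← hFint s hs]; exact hsv
  have hxy : v + s - δ - (v + s) = -δ := by ring
  have hhv : ∫ ω, h (v + s + q ω * (-δ)) ∂P = h v := by
    have := Hε (v + s - δ) ⟨by linarith [hs.1], by linarith [hs.2]⟩ (v + s)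
      ⟨by linarith [hs.1], by linarith [hs.2]⟩ (by linarith [hs.1]) (by linarith [hs.2])
    rw [hxy] at this
    exact this hsv
  have hhi := integrable_comp_of_mem_Icc P hh (hmeas s) (hqmem s hs)
  have hfi := integrable_comp_of_mem_Icc P hf (hmeas s) (hqmem s hs)
  have hae : ∀ᵐ ω ∂P, h (v + s + q ω * (-δ)) = h v := by
    have e : ∫ ω, (h v - h (v + s + q ω * (-δ))) ∂P = 0 := by
      rw [integral_sub (integrable_const _) hhi, hhv]; simp
    have := (integral_eq_zero_iff_of_nonneg
      (fun ω => by simpa [hvw] using hmax' _ (hqmem s hs ω)) ((integrable_const _).sub hhi)).1 e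
    filter_upwards [this] with ω hω
    simp only [Pi.sub_apply, Pi.zero_apply] at hω
    linarith
  -- Almost every value of the spread is a maximizer, hence not to the left of the least one.
  have hge : ∀ᵐ ω ∂P, v ≤ v + s + q ω * (-δ) := by
    filter_upwards [hae] with ω hω
    exact hleast ⟨hqmem s hs ω, by rw [mem_preimage, mem_singleton_iff, hω, hvw]⟩
  -- A spread weakly above `v` with `f`-mean `f v` is almost surely `v`, which makes `q` constant.
  have hfe : ∀ᵐ ω ∂P, v + s + q ω * (-δ) = v := by
    have e : ∫ ω, (f (v + s + q ω * (-δ)) - f v) ∂P = 0 := by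
      rw [integral_sub hfi (integrable_const _), hsv]; simp
    have := (integral_eq_zero_iff_of_nonneg_ae (by
      filter_upwards [hge] with ω hω
      simpa using hfm.monotoneOn hv (hqmem s hs ω) hω) (hfi.sub (integrable_const _))).1 e
    filter_upwards [this] with ω hω
    simp only [Pi.sub_apply, Pi.zero_apply] at hω
    exact hfm.injOn (hqmem s hs ω) hv (by linarith)
  refine hqc ⟨s / δ, ?_⟩
  filter_upwards [hfe] with ω hω
  rw [eq_div_iff hδpos.ne']
  linarith

/-- Two utility indices which, for one nondegenerate distribution of weights, have locally the same
certainty equivalents are affinely related. -/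
theorem exists_affine_of_local_certaintyEquivalent {Ω : Type*} [MeasurableSpace Ω] (P : Measure Ω)
    [IsProbabilityMeasure P] {q : Ω → ℝ} (hq : Measurable q) (hq₀ : ∀ ω, 0 ≤ q ω)
    (hq₁ : ∀ ω, q ω ≤ 1) (hqc : ¬ ∃ c : ℝ, ∀ᵐ ω ∂P, q ω = c)
    {f g : ℝ → ℝ} {a b : ℝ} (hab : a < b) (hf : ContinuousOn f (Icc a b))
    (hfm : StrictMonoOn f (Icc a b)) (hg : ContinuousOn g (Icc a b))
    (H : ∀ v ∈ Ioo a b, ∃ ε > 0, ∀ x ∈ Icc (v - ε) v, ∀ y ∈ Icc v (v + ε), a ≤ x → y ≤ b →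
      ∫ ω, f (y + q ω * (x - y)) ∂P = f v → ∫ ω, g (y + q ω * (x - y)) ∂P = g v) :
    ∃ α γ : ℝ, ∀ t ∈ Icc a b, g t = α * f t + γ := by
  have hfab : 0 < f b - f a :=
    sub_pos.2 (hfm (left_mem_Icc.2 hab.le) (right_mem_Icc.2 hab.le) hab)
  -- This slope makes `g - g a - α * (f - f a)` vanish at both endpoints; the maximum principle
  -- applied to it and to its negative (`σ = 1`, `σ = -1`) makes it zero.
  set α := (g b - g a) / (f b - f a) with hα
  have hαe : α * (f b - f a) = g b - g a := by rw [hα]; field_simp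
  have key : ∀ σ : ℝ, ∀ t ∈ Icc a b, σ * (g t - g a - α * (f t - f a)) ≤ 0 := by
    intro σ
    refine nonpos_of_local_mean_value P hq hq₀ hq₁ hqc hf hfm
      (h := fun t => σ * (g t - g a - α * (f t - f a)))
      (by fun_prop) (by ring) (by rw [hαe]; ring) ?_
    intro v hv
    obtain ⟨ε, hε, Hε⟩ := H v hv
    refine ⟨ε, hε, fun x hx y hy hax hyb hfv => ?_⟩
    have hgv := Hε x hx y hy hax hyb hfv
    have hmem : ∀ ω, y + q ω * (x - y) ∈ Icc a b := fun ω =>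
      add_mul_sub_mem_Icc ⟨hax, by linarith [hx.2, hv.2]⟩ ⟨by linarith [hy.1, hv.1], hyb⟩
        (hq₀ ω) (hq₁ ω)
    have hm : Measurable fun ω => y + q ω * (x - y) := by fun_prop
    have hgi := integrable_comp_of_mem_Icc P hg hm hmem
    have hfi := integrable_comp_of_mem_Icc P hf hm hmem
    have hlin : ∫ ω, (g (y + q ω * (x - y)) - α * f (y + q ω * (x - y)) + (α * f a - g a)) ∂P =
        g v - α * f v + (α * f a - g a) := by
      have hi : Integrable (fun ω => g (y + q ω * (x - y)) - α * f (y + q ω * (x - y))) P :=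
        hgi.sub (hfi.const_mul α)
      rw [integral_add hi (integrable_const _), integral_sub hgi (hfi.const_mul α), integral_const_mul, hgv, hfv]
      simp
    rw [integral_const_mul]
    congr 1
    calc _ = ∫ ω, (g (y + q ω * (x - y)) - α * f (y + q ω * (x - y)) + (α * f a - g a)) ∂P :=
          integral_congr_ae (Eventually.of_forall fun ω => by ring)
      _ = _ := by rw [hlin]; ring
  refine ⟨α, g a - α * f a, fun t ht => ?_⟩
  have h1 := key 1 t ht
  have h2 := key (-1) t ht
  linarith

/-! ### Affinely related translates characterize CARA indices -/

theorem caraExp_strictMono (θ : ℝ) : StrictMono (caraExp θ) := by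
  intro s t hst
  unfold caraExp
  split_ifs with h
  · have : -θ * t < -θ * s := by nlinarith
    simpa using Real.exp_lt_exp.2 this
  · exact hst

theorem continuous_caraExp (θ : ℝ) : Continuous (caraExp θ) := by
  unfold caraExp
  split_ifs <;> fun_prop

theorem exists_caraExp_add {θ : ℝ} (hθ : 0 ≤ θ) (τ : ℝ) :
    ∃ γ, ∀ t, caraExp θ (t + τ) = Real.exp (-θ * τ) * caraExp θ t + γ := by
  rcases hθ.eq_or_lt with rfl | h
  · exact ⟨τ, fun t => by simp [caraExp]⟩
  · refine ⟨0, fun t => ?_⟩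
    simp only [caraExp, h, if_true]
    rw [mul_add, Real.exp_add]
    ring

theorem sub_eq_mul_geom_sum {x : ℕ → ℝ} {α γ : ℝ} {N : ℕ}
    (hx : ∀ k < N, x (k + 1) = α * x k + γ) :
    ∀ k ≤ N, x k - x 0 = (x 1 - x 0) * ∑ i ∈ Finset.range k, α ^ i := by
  rcases Nat.eq_zero_or_pos N with rfl | hN
  · intro k hk
    obtain rfl : k = 0 := by omega
    simp
  have hstep : ∀ k < N, x (k + 1) - x k = (x 1 - x 0) * α ^ k := by
    intro k
    induction k with
    | zero => intro _; simp
    | succ k ih =>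
      intro hk
      have e1 := hx (k + 1) hk
      have e2 := hx k (by omega)
      have e3 := ih (by omega)
      rw [pow_succ]
      linear_combination e1 - e2 + α * e3
  intro k
  induction k with
  | zero => intro _; simp
  | succ k ih =>
    intro hk
    rw [Finset.sum_range_succ, mul_add, ← ih (by omega), ← hstep k (by omega)]
    ring

/-- A concave index whose small translates are affine transformations of itself is a CARA
exponential. -/
theorem exists_caraExp_of_translation {φ : ℝ → ℝ} {a b r : ℝ} (hab : a < b) (hr : 0 < r)
    (hφ : ContinuousOn φ (Icc a b)) (hmono : StrictMonoOn φ (Icc a b))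
    (hconc : ConcaveOn ℝ (Icc a b) φ)
    (H : ∀ τ, 0 < τ → τ < r → τ < b - a →
      ∃ α γ : ℝ, ∀ t ∈ Icc a (b - τ), φ (t + τ) = α * φ t + γ) :
    ∃ θ A B : ℝ, 0 ≤ θ ∧ 0 < A ∧ ∀ t ∈ Icc a b, φ t = A * caraExp θ t + B := by
  have hamem : a ∈ Icc a b := left_mem_Icc.2 hab.le
  have hbmem : b ∈ Icc a b := right_mem_Icc.2 hab.le
  set c := (a + b) / 2 with hc
  have hac : a < c := by rw [hc]; linarith
  have hcb : c < b := by rw [hc]; linarith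
  have hcmem : c ∈ Icc a b := ⟨hac.le, hcb.le⟩
  have hφac : 0 < φ c - φ a := sub_pos.2 (hmono hamem hcmem hac)
  have hφcb : 0 < φ b - φ c := sub_pos.2 (hmono hcmem hbmem hcb)
  have hR : φ b - φ c ≤ φ c - φ a := by
    have := hconc.2 hamem hbmem (by norm_num : (0 : ℝ) ≤ 1 / 2) (by norm_num : (0 : ℝ) ≤ 1 / 2)
      (by norm_num)
    simp only [smul_eq_mul] at this
    have e : 1 / 2 * a + 1 / 2 * b = c := by rw [hc]; ring
    rw [e] at this
    linarith
  -- The ratio of the increments over the two halves determines `θ` through `R = exp (-θ * (b - a) /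
  -- 2)`; concavity gives `R ≤ 1`, that is, `θ ≥ 0`.
  set R := (φ b - φ c) / (φ c - φ a) with hRdef
  have hRpos : 0 < R := div_pos hφcb hφac
  have hR1 : R ≤ 1 := (div_le_one hφac).2 hR
  set θ := -2 * Real.log R / (b - a) with hθ
  have hθ0 : 0 ≤ θ := div_nonneg (by nlinarith [Real.log_nonpos hRpos.le hR1]) (by linarith)
  set f := caraExp θ with hf
  have hfm : StrictMono f := caraExp_strictMono θ
  have hfab : 0 < f b - f a := sub_pos.2 (hfm hab)
  have hφab : 0 < φ b - φ a := by linarith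
  -- the two indices agree, up to normalization, on every fine uniform grid
  have grid : ∀ n : ℕ, 0 < n → (b - a) / (2 * n) < r → ∀ k ≤ 2 * n,
      (φ (a + k * ((b - a) / (2 * n))) - φ a) * (f b - f a) =
        (φ b - φ a) * (f (a + k * ((b - a) / (2 * n))) - f a) := by
    intro n hn hnr k hk
    have hn' : (0 : ℝ) < n := by exact_mod_cast hn
    set τ := (b - a) / (2 * n) with hτ
    have hτ0 : 0 < τ := div_pos (by linarith) (by linarith)
    have hnτ : n * τ = (b - a) / 2 := by rw [hτ]; field_simp
    have hn1 : (1 : ℝ) ≤ n := by exact_mod_cast hn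
    have hτba : τ < b - a := by nlinarith
    obtain ⟨α, γ, hα⟩ := H τ hτ0 hnr hτba
    obtain ⟨γ', hγ'⟩ := exists_caraExp_add hθ0 τ
    have hx := sub_eq_mul_geom_sum (x := fun k : ℕ => φ (a + k * τ)) (α := α) (γ := γ) (N := 2 * n)
      (by
        intro j hj
        have hj' : (j : ℝ) + 1 ≤ 2 * n := by exact_mod_cast hj
        have := hα (a + j * τ) ⟨by nlinarith [(Nat.cast_nonneg j : (0 : ℝ) ≤ j)], by nlinarith⟩
        rw [← this]
        push_cast
        ring_nf)
    have hy := sub_eq_mul_geom_sum (x := fun k : ℕ => f (a + k * τ)) (α := Real.exp (-θ * τ))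
      (γ := γ') (N := 2 * n)
      (by
        intro j hj
        have := hγ' (a + j * τ)
        rw [hf, ← this]
        push_cast
        ring_nf)
    have e0 : a + ((0 : ℕ) : ℝ) * τ = a := by simp
    have en : a + (n : ℝ) * τ = c := by rw [hnτ, hc]; ring
    have e2n : a + ((2 * n : ℕ) : ℝ) * τ = b := by push_cast; linarith
    simp only [e0] at hx hy
    set Δ := φ (a + ((1 : ℕ) : ℝ) * τ) - φ a with hΔ
    have hΔ0 : 0 < Δ := by
      refine sub_pos.2 (hmono hamem ⟨?_, ?_⟩ ?_) <;> push_cast <;> nlinarith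
    have hα0 : 0 < α := by
      have h2n : 2 ≤ 2 * n := by omega
      have h1 := hα a ⟨le_rfl, by linarith⟩
      have h2 := hα (a + τ) ⟨by linarith, by nlinarith⟩
      have h3 : φ (a + τ) < φ (a + τ + τ) :=
        hmono ⟨by linarith, by linarith⟩ ⟨by linarith, by nlinarith⟩ (by linarith)
      have h4 : φ a < φ (a + τ) := hmono hamem ⟨by linarith, by linarith⟩ (by linarith)
      have h5 : 0 < α * (φ (a + τ) - φ a) := by linarith
      exact (pos_iff_pos_of_mul_pos h5).2 (by linarith)
    -- With `2 * n` steps the midpoint is a grid point, and the geometric sum over the second half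
    -- is `α ^ n` times the sum over the first. So the ratio per step is pinned down by `R` on every
    -- grid.
    have hαR : α ^ n = R := by
      have h1 := hx n (by omega)
      have h2 := hx (2 * n) le_rfl
      rw [en] at h1
      rw [e2n, two_mul, Finset.sum_range_add] at h2
      simp only [pow_add, ← Finset.mul_sum] at h2
      rw [hRdef, eq_div_iff hφac.ne']
      linear_combination (α ^ n + 1) * h1 - h2
    have hαexp : α = Real.exp (-θ * τ) := by
      refine (pow_left_inj₀ hα0.le (Real.exp_pos _).le hn.ne').1 ?_
      rw [hαR, ← Real.exp_nat_mul]
      have : (n : ℝ) * (-θ * τ) = Real.log R := by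
        have hba : b - a ≠ 0 := by linarith
        calc (n : ℝ) * (-θ * τ) = -θ * (n * τ) := by ring
          _ = _ := by rw [hnτ, hθ]; field_simp
      rw [this, Real.exp_log hRpos]
    rw [← hαexp] at hy
    have hx1 := hx k hk
    have hx2 := hx (2 * n) le_rfl
    have hy1 := hy k hk
    have hy2 := hy (2 * n) le_rfl
    rw [e2n] at hx2 hy2
    rw [hx1, hx2, hy1, hy2]
    ring
  have all : ∀ t ∈ Icc a b, (φ t - φ a) * (f b - f a) = (φ b - φ a) * (f t - f a) := by
    intro t ht
    -- Rounding `t` down to the grid with `2 * n` steps; continuity carries the identity from grid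
    -- points to `t`.
    set s : ℕ → ℝ := fun n => a + (⌊(t - a) / (b - a) * (2 * n)⌋₊ : ℕ) * ((b - a) / (2 * n)) with hs
    have hba : 0 < b - a := by linarith
    set ρ := (t - a) / (b - a) with hρ
    have hρ0 : 0 ≤ ρ := div_nonneg (by linarith [ht.1]) hba.le
    have hρ1 : ρ ≤ 1 := (div_le_one hba).2 (by linarith [ht.2])
    have hρt : ρ * (b - a) = t - a := by rw [hρ]; field_simp
    have hkle : ∀ n : ℕ, ⌊ρ * (2 * n)⌋₊ ≤ 2 * n := fun n => by
      have : ρ * (2 * n) ≤ ((2 * n : ℕ) : ℝ) := by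
        push_cast
        nlinarith [(Nat.cast_nonneg n : (0 : ℝ) ≤ n)]
      exact (Nat.floor_le_floor this).trans (Nat.floor_natCast _).le
    have hst : Tendsto s atTop (𝓝 t) := by
      have hfl : Tendsto (fun n : ℕ => (⌊ρ * (2 * (n : ℝ))⌋₊ : ℝ) / (2 * (n : ℝ))) atTop (𝓝 ρ) :=
        (tendsto_nat_floor_mul_div_atTop hρ0).comp
          (tendsto_natCast_atTop_atTop.const_mul_atTop (by norm_num : (0 : ℝ) < 2))
      have := (hfl.mul_const (b - a)).const_add a
      rw [hρt, add_sub_cancel] at this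
      refine this.congr fun n => ?_
      simp only [hs]
      ring
    have hsmem : ∀ᶠ n in atTop, s n ∈ Icc a b := by
      filter_upwards [eventually_gt_atTop 0] with n hn
      have hn' : (0 : ℝ) < 2 * n := by positivity
      have h1 : ((⌊ρ * (2 * n)⌋₊ : ℕ) : ℝ) ≤ 2 * n := by exact_mod_cast hkle n
      have h2 : (2 * (n : ℝ)) * ((b - a) / (2 * n)) = b - a := by field_simp
      have h3 : 0 ≤ (b - a) / (2 * n) := by positivity
      refine ⟨?_, ?_⟩
      · simp only [hs]
        have : 0 ≤ ((⌊ρ * (2 * n)⌋₊ : ℕ) : ℝ) * ((b - a) / (2 * n)) := by positivity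
        linarith
      · simp only [hs]
        have := mul_le_mul_of_nonneg_right h1 h3
        linarith
    have hsmall : ∀ᶠ n : ℕ in atTop, (b - a) / (2 * n) < r := by
      have : Tendsto (fun n : ℕ => (b - a) / (2 * (n : ℝ))) atTop (𝓝 0) :=
        tendsto_const_nhds.div_atTop
          (tendsto_natCast_atTop_atTop.const_mul_atTop (by norm_num : (0 : ℝ) < 2))
      exact this.eventually_lt_const hr
    have hφs : Tendsto (fun n => φ (s n)) atTop (𝓝 (φ t)) :=
      (hφ t ht).tendsto.comp (tendsto_nhdsWithin_iff.2 ⟨hst, hsmem⟩)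
    have hfs : Tendsto (fun n => f (s n)) atTop (𝓝 (f t)) :=
      ((continuous_caraExp θ).tendsto t).comp hst
    refine tendsto_nhds_unique ((hφs.sub_const (φ a)).mul_const (f b - f a)) ?_
    refine ((hfs.sub_const (f a)).const_mul (φ b - φ a)).congr' ?_
    filter_upwards [eventually_gt_atTop 0, hsmall] with n hn hnr
    exact (grid n hn hnr _ (hkle n)).symm
  refine ⟨θ, (φ b - φ a) / (f b - f a), φ a - (φ b - φ a) / (f b - f a) * f a, hθ0,
    div_pos hφab hfab, fun t ht => ?_⟩
  have h := all t ht
  have h' : φ t - φ a = (φ b - φ a) / (f b - f a) * (f t - f a) := by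
    rw [div_mul_eq_mul_div, eq_div_iff hfab.ne']; exact h
  linarith

/-- A concave index whose certainty equivalents are, for one nondegenerate distribution of weights,
locally translation invariant is a CARA exponential. -/
theorem exists_caraExp_of_translation_invariant {Ω : Type*} [MeasurableSpace Ω] (P : Measure Ω)
    [IsProbabilityMeasure P] {q : Ω → ℝ} (hq : Measurable q) (hq₀ : ∀ ω, 0 ≤ q ω)
    (hq₁ : ∀ ω, q ω ≤ 1) (hqc : ¬ ∃ c : ℝ, ∀ᵐ ω ∂P, q ω = c)
    {φ : ℝ → ℝ} {a b r : ℝ} (hab : a < b) (hr : 0 < r)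
    (hφ : ContinuousOn φ (Icc a b)) (hmono : StrictMonoOn φ (Icc a b))
    (hconc : ConcaveOn ℝ (Icc a b) φ)
    (H : ∀ τ, 0 < τ → τ < r → ∀ v ∈ Ioo a (b - τ), ∃ ε > 0,
      ∀ x ∈ Icc (v - ε) v, ∀ y ∈ Icc v (v + ε), a ≤ x → y + τ ≤ b →
      ∫ ω, φ (y + q ω * (x - y)) ∂P = φ v →
      ∫ ω, φ (y + τ + q ω * (x - y)) ∂P = φ (v + τ)) :
    ∃ θ A B : ℝ, 0 ≤ θ ∧ 0 < A ∧ ∀ t ∈ Icc a b, φ t = A * caraExp θ t + B := by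
  refine exists_caraExp_of_translation hab hr hφ hmono hconc fun τ hτ hτr hτba => ?_
  have hsub : Icc a (b - τ) ⊆ Icc a b := Icc_subset_Icc_right (by linarith)
  -- The two indices compared on `[a, b - τ]` are `φ` and its translate by `τ`.
  refine exists_affine_of_local_certaintyEquivalent P hq hq₀ hq₁ hqc (by linarith)
    (hφ.mono hsub) (hmono.mono hsub) (g := fun t => φ (t + τ))
    (hφ.comp (by fun_prop) fun t ht => ⟨by linarith [ht.1], by linarith [ht.2]⟩) ?_
  intro v hv
  obtain ⟨ε, hε, Hε⟩ := H τ hτ hτr v hv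
  refine ⟨ε, hε, fun x hx y hy hax hyb hfv => ?_⟩
  rw [← Hε x hx y hy hax (by linarith) hfv]
  simp only [add_right_comm]

/-! ### Binary acts and integration against finitely additive probabilities -/

open Classical in
/-- The function with the value `x` on `E` and `y` off `E`. -/
def binaryAct {Y : Type*} (E : Set Y) (x y : ℝ) : Y → ℝ := fun ω => if ω ∈ E then x else y

theorem binaryAct_of_mem {Y : Type*} {E : Set Y} {x y : ℝ} {ω : Y} (h : ω ∈ E) :
    binaryAct E x y ω = x := if_pos h

theorem binaryAct_of_notMem {Y : Type*} {E : Set Y} {x y : ℝ} {ω : Y} (h : ω ∉ E) :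
    binaryAct E x y ω = y := if_neg h

theorem binaryAct_univ {Y : Type*} (x y : ℝ) : binaryAct (univ : Set Y) x y = fun _ => x :=
  funext fun _ => if_pos (mem_univ _)

theorem binaryAct_eq_indicator {Y : Type*} (E : Set Y) (x y : ℝ) (ω : Y) :
    binaryAct E x y ω = y + E.indicator (fun _ => 1) ω * (x - y) := by
  by_cases h : ω ∈ E
  · rw [binaryAct_of_mem h, indicator_of_mem h]; ring
  · rw [binaryAct_of_notMem h, indicator_of_notMem h]; ring

theorem binaryAct_mem {Y : Type*} {K : Set ℝ} {x y : ℝ} (hx : x ∈ K) (hy : y ∈ K) (E : Set Y)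
    (ω : Y) : binaryAct E x y ω ∈ K := by
  unfold binaryAct; split_ifs <;> assumption

theorem binaryAct_mem_boundedMeasurable {Y : Type*} {mY : MeasurableSpace Y} {K : Set ℝ} {x y : ℝ}
    (hx : x ∈ K) (hy : y ∈ K) {E : Set Y} (hE : MeasurableSet[mY] E) :
    binaryAct E x y ∈ boundedMeasurable K mY := by
  refine ⟨?_, binaryAct_mem hx hy E, max |x| |y|, fun ω => ?_⟩
  · exact Measurable.ite hE measurable_const measurable_const
  · unfold binaryAct
    split_ifs
    · exact le_max_left _ _
    · exact le_max_right _ _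

namespace FinAddProb

variable {Y : Type*} [MeasurableSpace Y] (p : FinAddProb Y)

theorem toFun_congr {A B : Set Y} (hA : MeasurableSet A) (hB : MeasurableSet B) (h : A = B) :
    p.toFun ⟨A, hA⟩ = p.toFun ⟨B, hB⟩ := by subst h; rfl

theorem toFun_empty : p.toFun ⟨∅, MeasurableSet.empty⟩ = 0 := by
  have h := p.union_eq ∅ ∅ MeasurableSet.empty MeasurableSet.empty (disjoint_empty _)
  rw [p.toFun_congr _ MeasurableSet.empty (union_empty ∅)] at h
  linarith

theorem toFun_add_compl {E : Set Y} (hE : MeasurableSet E) :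
    p.toFun ⟨E, hE⟩ + p.toFun ⟨Eᶜ, hE.compl⟩ = 1 := by
  rw [← p.union_eq E Eᶜ hE hE.compl disjoint_compl_right,
    p.toFun_congr _ MeasurableSet.univ (union_compl_self E), p.univ_eq]

theorem toFun_le_one (E : {A : Set Y // MeasurableSet A}) : p.toFun E ≤ 1 := by
  have := p.toFun_add_compl E.2
  linarith [p.nonneg ⟨(E : Set Y)ᶜ, E.2.compl⟩]

theorem toFun_mono {A B : Set Y} (hA : MeasurableSet A) (hB : MeasurableSet B) (h : A ⊆ B) :
    p.toFun ⟨A, hA⟩ ≤ p.toFun ⟨B, hB⟩ := by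
  have := p.union_eq A (B \ A) hA (hB.diff hA) disjoint_sdiff_right
  rw [p.toFun_congr _ hB (union_sdiff_cancel h)] at this
  linarith [p.nonneg ⟨B \ A, hB.diff hA⟩]

theorem toFun_inter_add_inter_compl {A E : Set Y} (hA : MeasurableSet A) (hE : MeasurableSet E) :
    p.toFun ⟨A, hA⟩ = p.toFun ⟨A ∩ E, hA.inter hE⟩ + p.toFun ⟨A ∩ Eᶜ, hA.inter hE.compl⟩ := by
  rw [← p.union_eq _ _ _ _
    (disjoint_compl_right.mono inter_subset_right inter_subset_right)]
  exact p.toFun_congr _ _ (inter_union_compl A E).symm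

theorem sum_toFun_preimage_inter (g : SimpleFunc Y ℝ) {E : Set Y} (hE : MeasurableSet E) :
    ∑ x ∈ g.range, p.toFun ⟨g ⁻¹' {x} ∩ E, (g.measurableSet_preimage {x}).inter hE⟩ =
      p.toFun ⟨E, hE⟩ := by
  have key : ∀ s : Finset ℝ,
      ∑ x ∈ s, p.toFun ⟨g ⁻¹' {x} ∩ E, (g.measurableSet_preimage {x}).inter hE⟩ =
        p.toFun ⟨g ⁻¹' s ∩ E, (g.measurableSet_preimage s).inter hE⟩ := by
    intro s
    induction s using Finset.induction_on with
    | empty =>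
      rw [Finset.sum_empty, ← p.toFun_empty]
      exact p.toFun_congr _ _ (by simp)
    | insert a s ha ih =>
      rw [Finset.sum_insert ha, ih, ← p.union_eq]
      · refine p.toFun_congr _ _ ?_
        ext ω
        simp only [mem_union, mem_inter_iff, mem_preimage, mem_singleton_iff, Finset.coe_insert,
          mem_insert_iff]
        tauto
      · rw [Set.disjoint_left]
        rintro ω ⟨h1, -⟩ ⟨h2, -⟩
        rw [mem_preimage, mem_singleton_iff] at h1
        rw [mem_preimage, h1] at h2
        exact ha h2
  rw [key]
  refine p.toFun_congr _ _ ?_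
  ext ω
  simp

/-- A binary act is itself simple, so the supremum defining the integral is attained. Splitting all
sums along `E` and its complement avoids treating `x = y` separately, where the range has only one
value. -/
theorem integral_binaryAct {E : Set Y} (hE : MeasurableSet E) (x y : ℝ) :
    p.integral (binaryAct E x y) = y + p.toFun ⟨E, hE⟩ * (x - y) := by
  have hsplit : ∀ g : SimpleFunc Y ℝ, p.simpleIntegral g =
      ∑ r ∈ g.range, r * p.toFun ⟨g ⁻¹' {r} ∩ E, (g.measurableSet_preimage {r}).inter hE⟩ +
      ∑ r ∈ g.range, r * p.toFun ⟨g ⁻¹' {r} ∩ Eᶜ,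
        (g.measurableSet_preimage {r}).inter hE.compl⟩ := by
    intro g
    rw [← Finset.sum_add_distrib]
    refine Finset.sum_congr rfl fun r _ => ?_
    rw [p.toFun_inter_add_inter_compl (g.measurableSet_preimage {r}) hE, mul_add]
  have hle : ∀ (g : SimpleFunc Y ℝ) (F : Set Y) (hF : MeasurableSet F) (z : ℝ),
      (∀ ω ∈ F, g ω ≤ z) →
      ∑ r ∈ g.range, r * p.toFun ⟨g ⁻¹' {r} ∩ F, (g.measurableSet_preimage {r}).inter hF⟩ ≤
        z * p.toFun ⟨F, hF⟩ := by
    intro g F hF z hz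
    rw [← p.sum_toFun_preimage_inter g hF, Finset.mul_sum]
    refine Finset.sum_le_sum fun r _ => ?_
    rcases (g ⁻¹' {r} ∩ F).eq_empty_or_nonempty with h | ⟨ω, h1, h2⟩
    · rw [p.toFun_congr _ MeasurableSet.empty h, p.toFun_empty]; simp
    · have : r ≤ z := by rw [← (h1 : g ω = r)]; exact hz ω h2
      exact mul_le_mul_of_nonneg_right this (p.nonneg _)
  have hge : ∀ (g : SimpleFunc Y ℝ) (F : Set Y) (hF : MeasurableSet F) (z : ℝ),
      (∀ ω ∈ F, g ω = z) →
      ∑ r ∈ g.range, r * p.toFun ⟨g ⁻¹' {r} ∩ F, (g.measurableSet_preimage {r}).inter hF⟩ =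
        z * p.toFun ⟨F, hF⟩ := by
    intro g F hF z hz
    rw [← p.sum_toFun_preimage_inter g hF, Finset.mul_sum]
    refine Finset.sum_congr rfl fun r _ => ?_
    rcases (g ⁻¹' {r} ∩ F).eq_empty_or_nonempty with h | ⟨ω, h1, h2⟩
    · rw [p.toFun_congr _ MeasurableSet.empty h, p.toFun_empty]; simp
    · rw [← (h1 : g ω = r), hz ω h2]
  have hc := p.toFun_add_compl hE
  have hval : x * p.toFun ⟨E, hE⟩ + y * p.toFun ⟨Eᶜ, hE.compl⟩ =
      y + p.toFun ⟨E, hE⟩ * (x - y) := by linear_combination y * hc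
  rw [← hval]
  refine IsGreatest.csSup_eq ⟨?_, ?_⟩
  · classical
    refine ⟨SimpleFunc.piecewise E hE (SimpleFunc.const Y x) (SimpleFunc.const Y y),
      fun ω => ?_, ?_⟩
    · by_cases h : ω ∈ E
      · simp [binaryAct, h]
      · simp [binaryAct, h]
    · rw [hsplit, hge _ E hE x, hge _ Eᶜ hE.compl y]
      · intro ω h
        simp [notMem_of_mem_compl h]
      · intro ω h
        simp [h]
  · rintro _ ⟨g, hg, rfl⟩
    rw [hsplit]
    refine add_le_add (hle g E hE x fun ω h => ?_) (hle g Eᶜ hE.compl y fun ω h => ?_)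
    · rw [← binaryAct_of_mem (x := x) (y := y) h]; exact hg ω
    · rw [← binaryAct_of_notMem (x := x) (y := y) h]; exact hg ω

end FinAddProb

/-! ### Smooth functionals on binary acts, and unambiguous events -/

section SmoothFunctional

variable {Y : Type*} [MeasurableSpace Y] (μ : SecondOrderPrior Y) {φ : ℝ → ℝ} {a b : ℝ}

theorem secondOrderUtility_binaryAct {E : Set Y} (hE : MeasurableSet E) (φ : ℝ → ℝ) (x y : ℝ) :
    secondOrderUtility φ μ (binaryAct E x y) =
      @integral (FinAddProb Y) ℝ _ _ μ.sigma μ.measure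
        (fun p => φ (y + p.toFun ⟨E, hE⟩ * (x - y))) := by
  unfold secondOrderUtility
  simp only [FinAddProb.integral_binaryAct _ hE]

/-- `Function.invFunOn` inverts `φ` only on the image of the interval, hence the membership
hypothesis; for binary acts it follows from the intermediate value theorem. -/
theorem smoothFunctional_eq_iff (hmono : StrictMonoOn φ (Icc a b)) {ξ : Y → ℝ} {v : ℝ}
    (hv : v ∈ Icc a b) (hmem : secondOrderUtility φ μ ξ ∈ φ '' Icc a b) :
    smoothFunctional (Icc a b) φ μ ξ = v ↔ secondOrderUtility φ μ ξ = φ v := by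
  have h1 := Function.invFunOn_mem hmem
  have h2 := Function.invFunOn_eq hmem
  constructor
  · intro h
    rw [← h]
    exact h2.symm
  · intro h
    exact hmono.injOn h1 hv (h2.trans h)

theorem secondOrderUtility_binaryAct_mem (hφ : ContinuousOn φ (Icc a b))
    (hmono : StrictMonoOn φ (Icc a b)) {E : Set Y} (hE : MeasurableSet E) {x y : ℝ}
    (hx : x ∈ Icc a b) (hy : y ∈ Icc a b) :
    secondOrderUtility φ μ (binaryAct E x y) ∈ φ '' Icc a b := by
  let _ := μ.sigma
  have := μ.isProb
  rw [secondOrderUtility_binaryAct μ hE]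
  have hm := μ.measurable_eval ⟨E, hE⟩
  exact exists_integral_comp_eq μ.measure hφ hmono
    (Z := fun p : FinAddProb Y => y + p.toFun ⟨E, hE⟩ * (x - y)) (by fun_prop)
    (fun p => add_mul_sub_mem_Icc hx hy (p.nonneg _) (p.toFun_le_one _))

theorem smoothFunctional_binaryAct_eq_iff (hφ : ContinuousOn φ (Icc a b))
    (hmono : StrictMonoOn φ (Icc a b)) {E : Set Y} (hE : MeasurableSet E) {x y v : ℝ}
    (hx : x ∈ Icc a b) (hy : y ∈ Icc a b) (hv : v ∈ Icc a b) :
    smoothFunctional (Icc a b) φ μ (binaryAct E x y) = v ↔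
      @integral (FinAddProb Y) ℝ _ _ μ.sigma μ.measure
        (fun p => φ (y + p.toFun ⟨E, hE⟩ * (x - y))) = φ v := by
  rw [← secondOrderUtility_binaryAct μ hE]
  exact smoothFunctional_eq_iff μ hmono hv
    (secondOrderUtility_binaryAct_mem μ hφ hmono hE hx hy)

theorem smoothFunctional_binaryAct_mem (hφ : ContinuousOn φ (Icc a b))
    (hmono : StrictMonoOn φ (Icc a b)) {E : Set Y} (hE : MeasurableSet E) {x y : ℝ}
    (hx : x ∈ Icc a b) (hy : y ∈ Icc a b) :
    smoothFunctional (Icc a b) φ μ (binaryAct E x y) ∈ Icc a b :=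
  Function.invFunOn_mem (secondOrderUtility_binaryAct_mem μ hφ hmono hE hx hy)

theorem smoothFunctional_const (hφ : ContinuousOn φ (Icc a b))
    (hmono : StrictMonoOn φ (Icc a b)) {c : ℝ} (hc : c ∈ Icc a b) :
    smoothFunctional (Icc a b) φ μ (fun _ => c) = c := by
  let _ := μ.sigma
  have := μ.isProb
  rw [← binaryAct_univ c c,
    smoothFunctional_binaryAct_eq_iff μ hφ hmono MeasurableSet.univ hc hc hc]
  simp

/-- If the functional is continuous and the probability of every event of a generating algebra is
unambiguous, then the probability of every event is unambiguous. -/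
theorem ae_const_of_generateFrom (hab : a < b) (hφ : ContinuousOn φ (Icc a b))
    (hmono : StrictMonoOn φ (Icc a b))
    (hcont : ContinuousFunctional (Icc a b) (smoothFunctional (Icc a b) φ μ))
    {G : Set (Set Y)} (hG : ‹MeasurableSpace Y› = MeasurableSpace.generateFrom G)
    (hπ : IsPiSystem G)
    (hconst : ∀ E ∈ G, ∀ hE : MeasurableSet E,
      ∃ c : ℝ, ∀ᵐ p ∂μ.measure, p.toFun ⟨E, hE⟩ = c) :
    ∀ E (hE : MeasurableSet E), ∃ c : ℝ, ∀ᵐ p ∂μ.measure, p.toFun ⟨E, hE⟩ = c := by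
  let _ := μ.sigma
  have := μ.isProb
  have ha : a ∈ Icc a b := left_mem_Icc.2 hab.le
  have hb : b ∈ Icc a b := right_mem_Icc.2 hab.le
  have hba : 0 < b - a := sub_pos.2 hab
  refine MeasurableSpace.induction_on_inter hG hπ ⟨0, ?_⟩ (fun E hE => hconst E hE _) ?_ ?_
  · exact Eventually.of_forall fun p => p.toFun_empty
  · rintro E hE ⟨c, hc⟩
    refine ⟨1 - c, ?_⟩
    filter_upwards [hc] with p hp
    rw [← hp, ← p.toFun_add_compl hE]
    ring
  -- Each `p` is only finitely additive, so `p` of the union may exceed the limit of the partial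
  -- sums. Continuity of the functional excludes this for almost every `p`.
  · intro f hdisj hf hfc
    have hFm : ∀ n, MeasurableSet (⋃ i ∈ Finset.range n, f i) := fun n =>
      Finset.measurableSet_biUnion _ fun i _ => hf i
    have hpart : ∀ n, ∃ c : ℝ, ∀ᵐ p ∂μ.measure, p.toFun ⟨_, hFm n⟩ = c := by
      intro n
      induction n with
      | zero =>
        refine ⟨0, Eventually.of_forall fun p => ?_⟩
        rw [p.toFun_congr _ MeasurableSet.empty (by simp), p.toFun_empty]
      | succ n ih =>
        obtain ⟨c, hc⟩ := ih
        obtain ⟨d, hd⟩ := hfc n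
        refine ⟨c + d, ?_⟩
        filter_upwards [hc, hd] with p h1 h2
        rw [← h1, ← h2, ← p.union_eq]
        · refine p.toFun_congr _ _ ?_
          rw [Finset.range_add_one, Finset.set_biUnion_insert, union_comm]
        · simp only [disjoint_iUnion_left]
          intro i hi
          exact hdisj (Finset.mem_range.1 hi).ne
    choose c hc using hpart
    have hcI : ∀ n, 0 ≤ c n ∧ c n ≤ 1 := fun n => by
      obtain ⟨p, hp⟩ := (hc n).exists
      rw [← hp]
      exact ⟨p.nonneg _, p.toFun_le_one _⟩
    have hEm : MeasurableSet (⋃ i, f i) := MeasurableSet.iUnion hf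
    have hIn : ∀ n, smoothFunctional (Icc a b) φ μ (binaryAct (⋃ i ∈ Finset.range n, f i) b a) =
        a + c n * (b - a) := by
      intro n
      rw [smoothFunctional_binaryAct_eq_iff μ hφ hmono (hFm n) hb ha
        (add_mul_sub_mem_Icc hb ha (hcI n).1 (hcI n).2)]
      have : (fun p : FinAddProb Y => φ (a + p.toFun ⟨_, hFm n⟩ * (b - a))) =ᵐ[μ.measure]
          fun _ => φ (a + c n * (b - a)) := by
        filter_upwards [hc n] with p hp
        rw [hp]
      rw [integral_congr_ae this]
      simp
    have hlim := hcont (fun n => binaryAct (⋃ i ∈ Finset.range n, f i) b a)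
      (binaryAct (⋃ i, f i) b a)
      (fun n => binaryAct_mem_boundedMeasurable hb ha (hFm n))
      (binaryAct_mem_boundedMeasurable hb ha hEm) (by
        intro ω
        by_cases h : ω ∈ ⋃ i, f i
        · obtain ⟨i, hi⟩ := mem_iUnion.1 h
          refine tendsto_const_nhds.congr' ?_
          filter_upwards [eventually_gt_atTop i] with n hn
          rw [binaryAct_of_mem h, binaryAct_of_mem]
          exact mem_biUnion (Finset.mem_coe.2 (Finset.mem_range.2 hn)) hi
        · refine tendsto_const_nhds.congr fun n => ?_
          rw [binaryAct_of_notMem h, binaryAct_of_notMem]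
          intro h'
          exact h (iUnion₂_subset_iUnion _ _ h'))
    simp only [hIn] at hlim
    set v := smoothFunctional (Icc a b) φ μ (binaryAct (⋃ i, f i) b a) with hv
    have hvmem : v ∈ Icc a b := smoothFunctional_binaryAct_mem μ hφ hmono hEm hb ha
    have hvint := (smoothFunctional_binaryAct_eq_iff μ hφ hmono hEm hb ha hvmem).1 rfl
    have hm := μ.measurable_eval ⟨_, hEm⟩
    have hmem : ∀ p : FinAddProb Y, a + p.toFun ⟨_, hEm⟩ * (b - a) ∈ Icc a b := fun p =>
      add_mul_sub_mem_Icc hb ha (p.nonneg _) (p.toFun_le_one _)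
    have hint : Integrable (fun p : FinAddProb Y => φ (a + p.toFun ⟨_, hEm⟩ * (b - a)))
        μ.measure := integrable_comp_of_mem_Icc μ.measure hφ (by fun_prop) hmem
    -- Monotonicity of `p` bounds its payoff below by those of the partial unions, which tend to
    -- `v`. As the `φ`-mean is `φ v`, equality holds almost surely.
    have hge : ∀ᵐ p ∂μ.measure, v ≤ a + p.toFun ⟨_, hEm⟩ * (b - a) := by
      filter_upwards [ae_all_iff.2 hc] with p hp
      refine le_of_tendsto hlim (Eventually.of_forall fun n => ?_)
      rw [← hp n]
      have := p.toFun_mono (hFm n) hEm (iUnion₂_subset_iUnion _ _)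
      nlinarith
    refine ⟨(v - a) / (b - a), ?_⟩
    have e : ∫ p, (φ (a + p.toFun ⟨_, hEm⟩ * (b - a)) - φ v) ∂μ.measure = 0 := by
      rw [integral_sub hint (integrable_const _), hvint]; simp
    have h0 := (integral_eq_zero_iff_of_nonneg_ae (by
      filter_upwards [hge] with p hp
      simpa using hmono.monotoneOn hvmem (hmem p) hp) (hint.sub (integrable_const _))).1 e
    filter_upwards [h0] with p hp
    simp only [Pi.sub_apply, Pi.zero_apply] at hp
    have := hmono.injOn (hmem p) hvmem (by linarith)
    rw [eq_div_iff hba.ne', ← this]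
    ring

end SmoothFunctional

/-! ### Local translation invariance forces CARA -/

section Translation

/-- For the acts which depend on the event `E` only, and on payoffs near a common interior point,
the functional `I` commutes with the addition of constants `τ < r`. -/
def LocallyTranslationInvariant {Y : Type*} (I : (Y → ℝ) → ℝ) (a b r : ℝ) (E : Set Y) : Prop :=
  ∀ τ, 0 < τ → τ < r → ∀ v ∈ Ioo a (b - τ), ∃ ε > 0,
    ∀ x ∈ Icc (v - ε) v, ∀ y ∈ Icc v (v + ε), a ≤ x → y + τ ≤ b →
      I (binaryAct E (x + τ) (y + τ)) = I (binaryAct E x y) + τ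

variable {Y : Type*} [mY : MeasurableSpace Y] (μ : SecondOrderPrior Y) {φ : ℝ → ℝ} {a b r : ℝ}

/-- Here the random weight is `p(E)`, distributed according to `μ`; ambiguity of `E` is its
nondegeneracy. -/
theorem exists_caraExp_of_ambiguous (hab : a < b) (hr : 0 < r) (hφ : ContinuousOn φ (Icc a b))
    (hmono : StrictMonoOn φ (Icc a b)) (hconc : ConcaveOn ℝ (Icc a b) φ) {E : Set Y}
    (hE : MeasurableSet E)
    (hamb : ¬ ∃ c : ℝ, ∀ᵐ p ∂μ.measure, p.toFun ⟨E, hE⟩ = c)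
    (hI : LocallyTranslationInvariant (smoothFunctional (Icc a b) φ μ) a b r E) :
    ∃ θ A B : ℝ, 0 ≤ θ ∧ 0 < A ∧ ∀ t ∈ Icc a b, φ t = A * caraExp θ t + B := by
  let _ := μ.sigma
  have := μ.isProb
  refine exists_caraExp_of_translation_invariant μ.measure (μ.measurable_eval ⟨E, hE⟩)
    (fun p => p.nonneg _) (fun p => p.toFun_le_one _) hamb hab hr hφ hmono hconc ?_
  intro τ hτ hτr v hv
  obtain ⟨ε, hε, Hε⟩ := hI τ hτ hτr v hv
  refine ⟨ε, hε, fun x hx y hy hax hyb h => ?_⟩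
  have hvI : v ∈ Icc a b := ⟨hv.1.le, by linarith [hv.2]⟩
  have hxI : x ∈ Icc a b := ⟨hax, by linarith [hx.2, hv.2]⟩
  have hyI : y ∈ Icc a b := ⟨by linarith [hy.1, hv.1], by linarith⟩
  have h1 := (smoothFunctional_binaryAct_eq_iff μ hφ hmono hE hxI hyI hvI).2 h
  have h2 := Hε x hx y hy hax hyb
  rw [h1, smoothFunctional_binaryAct_eq_iff μ hφ hmono hE ⟨by linarith, by linarith [hx.2, hv.2]⟩
    ⟨by linarith [hy.1, hv.1], hyb⟩ ⟨by linarith [hv.1], by linarith [hv.2]⟩] at h2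
  simpa only [add_sub_add_right_eq_sub] using h2

/-- Here the random weight is the indicator of an event with `π`-probability strictly between `0`
and `1`. That event is not known in advance, so invariance is assumed for all measurable events. -/
theorem exists_caraExp_of_identified (hab : a < b) (hr : 0 < r) (hφ : ContinuousOn φ (Icc a b))
    (hmono : StrictMonoOn φ (Icc a b)) (hconc : ConcaveOn ℝ (Icc a b) φ)
    (hid : IsIdentified (Icc a b) φ μ)
    (hI : ∀ E, MeasurableSet E →
      LocallyTranslationInvariant (smoothFunctional (Icc a b) φ μ) a b r E) :
    ∃ θ A B : ℝ, 0 ≤ θ ∧ 0 < A ∧ ∀ t ∈ Icc a b, φ t = A * caraExp θ t + B := by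
  obtain ⟨mB, hmB, π, hπ, ⟨E, hE, hE0, hE1⟩, hrep⟩ := hid
  have hqc : ¬ ∃ c : ℝ, ∀ᵐ ω ∂π, E.indicator (fun _ => (1 : ℝ)) ω = c := by
    rintro ⟨c, hc⟩
    by_cases h : c = 1
    · have : ∀ᵐ ω ∂π, ω ∈ E := by
        filter_upwards [hc] with ω hω
        by_contra hn
        rw [indicator_of_notMem hn, h] at hω
        exact zero_ne_one hω
      exact hE1.ne ((prob_compl_eq_zero_iff hE).1 this)
    · have : ∀ᵐ ω ∂π, ω ∉ E := by
        filter_upwards [hc] with ω hω hn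
        rw [indicator_of_mem hn] at hω
        exact h hω.symm
      rw [ae_iff] at this
      simp only [not_not] at this
      exact hE0.ne' this
  have hq : Measurable[mB] (E.indicator fun _ => (1 : ℝ)) := measurable_const.indicator hE
  have hq0 : ∀ ω, 0 ≤ E.indicator (fun _ => (1 : ℝ)) ω :=
    fun ω => indicator_nonneg (fun _ _ => zero_le_one) ω
  have hq1 : ∀ ω, E.indicator (fun _ => (1 : ℝ)) ω ≤ 1 :=
    fun ω => indicator_le_self' (fun _ _ => zero_le_one) ω
  refine exists_caraExp_of_translation_invariant π hq hq0 hq1 hqc hab hr hφ hmono hconc ?_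
  intro τ hτ hτr v hv
  obtain ⟨ε, hε, Hε⟩ := hI E (hmB _ hE) τ hτ hτr v hv
  refine ⟨ε, hε, fun x hx y hy hax hyb h => ?_⟩
  have hvI : v ∈ Icc a b := ⟨hv.1.le, by linarith [hv.2]⟩
  have hxI : x ∈ Icc a b := ⟨hax, by linarith [hx.2, hv.2]⟩
  have hyI : y ∈ Icc a b := ⟨by linarith [hy.1, hv.1], by linarith⟩
  have hxI' : x + τ ∈ Icc a b := ⟨by linarith, by linarith [hx.2, hv.2]⟩
  have hyI' : y + τ ∈ Icc a b := ⟨by linarith [hy.1, hv.1], hyb⟩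
  have hEY : MeasurableSet[mY] E := hmB _ hE
  have hIm := fun {x y : ℝ} (hx : x ∈ Icc a b) (hy : y ∈ Icc a b) =>
    @smoothFunctional_binaryAct_mem Y mY μ φ a b hφ hmono E hEY x y hx hy
  -- Identification replaces the second-order integral by an expectation under `π`, so the
  -- functional is a certainty equivalent with the indicator as weight.
  have hcert : ∀ x y : ℝ, x ∈ Icc a b → y ∈ Icc a b →
      φ (@smoothFunctional Y mY (Icc a b) φ μ (binaryAct E x y)) =
        ∫ ω, φ (y + E.indicator (fun _ => (1 : ℝ)) ω * (x - y)) ∂π := by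
    intro x y hx hy
    rw [hrep (binaryAct E x y) (binaryAct_mem_boundedMeasurable hx hy hE)]
    simp only [binaryAct_eq_indicator]
    exact Function.invFunOn_eq (exists_integral_comp_eq π hφ hmono
      (Z := fun ω => y + E.indicator (fun _ => (1 : ℝ)) ω * (x - y))
      ((hq.mul_const _).const_add _)
      (fun ω => add_mul_sub_mem_Icc hx hy (hq0 ω) (hq1 ω)))
  have h1 : @smoothFunctional Y mY (Icc a b) φ μ (binaryAct E x y) = v :=
    hmono.injOn (hIm hxI hyI) hvI
      ((hcert x y hxI hyI).trans h)
  have h2 := hcert (x + τ) (y + τ) hxI' hyI'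
  rw [Hε x hx y hy hax hyb, h1, add_sub_add_right_eq_sub] at h2
  exact h2.symm

/-- When `p(E)` is almost surely `c`, the index cancels and the functional equals `y + c * (x - y)`.
No locality is needed, so the radius `1` is arbitrary. -/
theorem locallyTranslationInvariant_of_ae_const (hφ : ContinuousOn φ (Icc a b))
    (hmono : StrictMonoOn φ (Icc a b)) {E : Set Y} (hE : MeasurableSet E) {c : ℝ}
    (hc : ∀ᵐ p ∂μ.measure, p.toFun ⟨E, hE⟩ = c) :
    LocallyTranslationInvariant (smoothFunctional (Icc a b) φ μ) a b r E := by
  let _ := μ.sigma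
  have := μ.isProb
  obtain ⟨p₀, hp₀⟩ := hc.exists
  have hI : ∀ x ∈ Icc a b, ∀ y ∈ Icc a b,
      smoothFunctional (Icc a b) φ μ (binaryAct E x y) = y + c * (x - y) := by
    intro x hx y hy
    rw [smoothFunctional_binaryAct_eq_iff μ hφ hmono hE hx hy
      (add_mul_sub_mem_Icc hx hy (hp₀ ▸ p₀.nonneg _) (hp₀ ▸ p₀.toFun_le_one _))]
    have : (fun p : FinAddProb Y => φ (y + p.toFun ⟨E, hE⟩ * (x - y))) =ᵐ[μ.measure]
        fun _ => φ (y + c * (x - y)) := by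
      filter_upwards [hc] with p hp
      rw [hp]
    rw [integral_congr_ae this]
    simp
  refine fun τ hτ hτr v hv => ⟨1, one_pos, fun x hx y hy hax hyb => ?_⟩
  rw [hI x ⟨hax, by linarith [hx.2, hv.2]⟩ y ⟨by linarith [hy.1, hv.1], by linarith⟩,
    hI (x + τ) ⟨by linarith, by linarith [hx.2, hv.2]⟩ (y + τ) ⟨by linarith [hy.1, hv.1], hyb⟩]
  ring

end Translation

/-! ### Ranges of period utility and lifetime utility -/

section Utility

variable {C : Type*} [MeasurableSpace C] {u : ProbabilityMeasure C → ℝ} {β m M : ℝ}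

/-- Lotteries over a compact metrizable space form a compact space, so `u` has a worst and a best
lottery; their mixtures fill the interval between the two utilities. -/
theorem exists_range_eq_Icc [TopologicalSpace C] [CompactSpace C]
    [TopologicalSpace.MetrizableSpace C] [BorelSpace C] (hcont : Continuous u)
    (haff : ∀ (α : unitInterval) (x y : ProbabilityMeasure C),
      u (lotteryMix α x y) = α * u x + (1 - α) * u y)
    (hnc : ∃ x y, u x ≠ u y) : ∃ m M, m < M ∧ range u = Icc m M := by
  obtain ⟨x₀, y₀, hxy⟩ := hnc
  obtain ⟨x, -, hx⟩ := isCompact_univ.exists_isMinOn ⟨x₀, mem_univ _⟩ hcont.continuousOn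
  obtain ⟨y, -, hy⟩ := isCompact_univ.exists_isMaxOn ⟨x₀, mem_univ _⟩ hcont.continuousOn
  have hx' : ∀ z, u x ≤ u z := fun z => hx (mem_univ z)
  have hy' : ∀ z, u z ≤ u y := fun z => hy (mem_univ z)
  have hlt : u x < u y := by
    by_contra! h
    exact hxy (le_antisymm ((hy' _).trans (h.trans (hx' _))) ((hy' _).trans (h.trans (hx' _))))
  refine ⟨u x, u y, hlt, subset_antisymm ?_ ?_⟩
  · rintro _ ⟨z, rfl⟩
    exact ⟨hx' z, hy' z⟩
  · intro w hw
    have hd : 0 < u y - u x := sub_pos.2 hlt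
    refine ⟨lotteryMix ⟨(w - u x) / (u y - u x), div_nonneg (by linarith [hw.1]) hd.le,
      (div_le_one hd).2 (by linarith [hw.2])⟩ y x, ?_⟩
    rw [haff]
    simp only
    field_simp
    ring

theorem summable_lifetimeUtility (hβ : β ∈ Ioo (0 : ℝ) 1) (hu : ∀ x, u x ∈ Icc m M)
    (d : ℕ → ProbabilityMeasure C) : Summable fun t => β ^ t * u (d t) := by
  refine Summable.of_norm_bounded
    ((summable_geometric_of_lt_one hβ.1.le hβ.2).mul_right (max |m| |M|)) fun t => ?_
  rw [norm_mul, Real.norm_eq_abs, Real.norm_eq_abs, abs_of_pos (pow_pos hβ.1 t)]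
  exact mul_le_mul_of_nonneg_left (abs_le_max_abs_abs (hu _).1 (hu _).2) (pow_pos hβ.1 t).le

theorem lifetimeUtility_eq_add (hβ : β ∈ Ioo (0 : ℝ) 1) (hu : ∀ x, u x ∈ Icc m M)
    (d : ℕ → ProbabilityMeasure C) :
    lifetimeUtility u β d = u (d 0) + β * lifetimeUtility u β (fun t => d (t + 1)) := by
  unfold lifetimeUtility
  rw [(summable_lifetimeUtility hβ hu d).tsum_eq_zero_add, ← tsum_mul_left]
  simp only [pow_zero, one_mul, pow_succ]
  congr 1
  exact tsum_congr fun t => by ring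

theorem lifetimeUtility_const (hβ : β ∈ Ioo (0 : ℝ) 1) (x : ProbabilityMeasure C) :
    lifetimeUtility u β (fun _ => x) = u x / (1 - β) := by
  unfold lifetimeUtility
  rw [tsum_mul_right, tsum_geometric_of_lt_one hβ.1.le hβ.2]
  ring

theorem lifetimeUtility_update (hβ : β ∈ Ioo (0 : ℝ) 1) (hu : ∀ x, u x ∈ Icc m M)
    (d : ℕ → ProbabilityMeasure C) (t : ℕ) (x : ProbabilityMeasure C) :
    lifetimeUtility u β (Function.update d t x) =
      lifetimeUtility u β d + β ^ t * (u x - u (d t)) := by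
  have h := (summable_lifetimeUtility hβ hu (Function.update d t x)).hasSum.sub
    (summable_lifetimeUtility hβ hu d).hasSum
  have h2 := hasSum_single (f := fun j => β ^ j * u (Function.update d t x j) - β ^ j * u (d j)) t
    (fun j hj => by simp [Function.update_of_ne hj])
  have := h.unique h2
  simp only [Function.update_self] at this
  unfold lifetimeUtility
  linarith

theorem utilityRange_eq_Icc (hβ : β ∈ Ioo (0 : ℝ) 1) (hu : range u = Icc m M) :
    utilityRange u β = Icc (m / (1 - β)) (M / (1 - β)) := by
  have hu' : ∀ x, u x ∈ Icc m M := fun x => hu ▸ mem_range_self x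
  have h1β : 0 < 1 - β := sub_pos.2 hβ.2
  refine subset_antisymm ?_ ?_
  · rintro _ ⟨d, rfl⟩
    have hg := summable_geometric_of_lt_one hβ.1.le hβ.2
    have hd := summable_lifetimeUtility hβ hu' d
    have e : ∀ z : ℝ, ∑' t : ℕ, β ^ t * z = z / (1 - β) := fun z => by
      rw [tsum_mul_right, tsum_geometric_of_lt_one hβ.1.le hβ.2]; ring
    rw [← e m, ← e M]
    exact ⟨(hg.mul_right m).tsum_le_tsum
        (fun t => mul_le_mul_of_nonneg_left (hu' _).1 (pow_pos hβ.1 t).le) hd,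
      hd.tsum_le_tsum
        (fun t => mul_le_mul_of_nonneg_left (hu' _).2 (pow_pos hβ.1 t).le) (hg.mul_right M)⟩
  · intro v hv
    have hv1 := (div_le_iff₀ h1β).1 hv.1
    have hv2 := (le_div_iff₀ h1β).1 hv.2
    obtain ⟨x, hx⟩ : v * (1 - β) ∈ range u := hu ▸ ⟨hv1, hv2⟩
    exact ⟨fun _ => x, by rw [lifetimeUtility_const hβ, hx]; field_simp⟩

end Utility

/-! ### Finite-horizon events and plans with two branches -/

theorem info_mono (S : Type*) [MeasurableSpace S] : Monotone (info S) := by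
  intro s t hst
  have h : Measurable[info S t] fun (ω : ℕ → S) (i : Fin t) => ω i := comap_measurable _
  rw [info, ← measurable_iff_comap_le]
  refine @measurable_pi_lambda _ _ _ (info S t) _ _ fun i => ?_
  exact (measurable_pi_apply (Fin.castLE hst i)).comp h

theorem measurableSet_of_info {S : Type*} [MeasurableSpace S] {t : ℕ} {E : Set (ℕ → S)}
    (hE : MeasurableSet[info S t] E) : MeasurableSet E := by
  rw [← iSup_info S]
  exact le_iSup (info S) t _ hE

theorem measurableSet_info_first {S : Type*} [MeasurableSpace S] {A : Set S}
    (hA : MeasurableSet A) : MeasurableSet[info S 1] {ω : ℕ → S | ω 0 ∈ A} := by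
  have h : Measurable[info S 1] fun (ω : ℕ → S) (i : Fin 1) => ω i := comap_measurable _
  exact (measurable_pi_apply (0 : Fin 1)).comp h hA

section Plans

variable {S C : Type*} [MeasurableSpace S] [TopologicalSpace C] [MeasurableSpace C]
  [OpensMeasurableSpace C]

/-- The deterministic plan `d`. -/
def constPlan (S : Type*) [MeasurableSpace S] (d : ℕ → ProbabilityMeasure C) : Plan S C where
  toFun t _ := d t
  adapted t := @measurable_const _ _ (borel _) (info S t) _

open Classical in
/-- The plan which follows `d₁` on the event `E` and `d₂` off `E`, where `d₁` and `d₂` agree until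
`E` is revealed. -/
def binaryPlan (t : ℕ) (E : Set (ℕ → S)) (hE : MeasurableSet[info S t] E)
    (d₁ d₂ : ℕ → ProbabilityMeasure C) (hd : ∀ j < t, d₁ j = d₂ j) : Plan S C where
  toFun j ω := if ω ∈ E then d₁ j else d₂ j
  adapted j := by
    rcases lt_or_ge j t with h | h
    · simp only [hd j h, ite_self]
      exact @measurable_const _ _ (borel _) (info S j) _
    · exact @Measurable.ite _ _ (fun _ => d₁ j) (fun _ => d₂ j) (info S j) (borel _) (· ∈ E) _
        (info_mono S h _ hE)
        (@measurable_const _ _ (borel _) (info S j) _)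
        (@measurable_const _ _ (borel _) (info S j) _)

theorem utility_binaryPlan (u : ProbabilityMeasure C → ℝ) (β : ℝ) (t : ℕ) (E : Set (ℕ → S))
    (hE : MeasurableSet[info S t] E) (d₁ d₂ : ℕ → ProbabilityMeasure C)
    (hd : ∀ j < t, d₁ j = d₂ j) :
    (binaryPlan t E hE d₁ d₂ hd).utility u β =
      binaryAct E (lifetimeUtility u β d₁) (lifetimeUtility u β d₂) := by
  funext ω
  by_cases h : ω ∈ E
  · simp [Plan.utility, binaryPlan, binaryAct, h]
  · simp [Plan.utility, binaryPlan, binaryAct, h]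

theorem Plan.ext_toFun {h g : Plan S C} (hg : h.toFun = g.toFun) : h = g := by
  cases h; cases g; cases hg; rfl

theorem continuation_binaryPlan_first (A : Set S)
    (hE : MeasurableSet[info S 1] {ω : ℕ → S | ω 0 ∈ A}) (d₁ d₂ : ℕ → ProbabilityMeasure C)
    (hd : ∀ j < 1, d₁ j = d₂ j) (s : S) :
    (s ∈ A → (binaryPlan 1 _ hE d₁ d₂ hd).continuation s = constPlan S fun j => d₁ (j + 1)) ∧
    (s ∉ A → (binaryPlan 1 _ hE d₁ d₂ hd).continuation s = constPlan S fun j => d₂ (j + 1)) := by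
  constructor
  · intro hs
    refine Plan.ext_toFun ?_
    funext j ω
    exact if_pos hs
  · intro hs
    refine Plan.ext_toFun ?_
    funext j ω
    exact if_neg hs

end Plans

/-! ### Translation invariance from the two representations -/

section Representation

variable {S C : Type*} [MeasurableSpace S] [TopologicalSpace C] [MeasurableSpace C]
  [OpensMeasurableSpace C] {pref : Plan S C → Plan S C → Prop} {φ₀ φ₁ : ℝ → ℝ}
  {u : ProbabilityMeasure C → ℝ} {β m M : ℝ} {μ₀ : SecondOrderPrior (ℕ → S)}
  {μ₁ : SecondOrderPrior S}

/-- The normalized ex-ante and recursive representations coincide. -/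
theorem SmoothRepresentations.exists_common_value [Nonempty S]
    (hrep : SmoothRepresentations pref φ₀ φ₁ u β μ₀ μ₁) (hu : range u = Icc m M) :
    ∃ V : Plan S C → ℝ,
      (∀ h, V h = smoothFunctional (utilityRange u β) φ₀ μ₀ (h.utility u β)) ∧
      (∀ (h : Plan S C) (ω : ℕ → S), V h = u (h.toFun 0 ω) +
        β * smoothFunctional (utilityRange u β) φ₁ μ₁ (fun s => V (h.continuation s))) ∧
      ∀ d, V (constPlan S d) = lifetimeUtility u β d := by
  have hβ := hrep.beta_mem
  have hu' : ∀ x, u x ∈ Icc m M := fun x => hu ▸ mem_range_self x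
  have hK := utilityRange_eq_Icc hβ hu
  obtain ⟨V, hVmem, hV, hVrec⟩ := hrep.recursive
  have hc₀ := hrep.continuous₀
  have hc₁ := hrep.continuous₁
  have hs₀ := hrep.strictMono₀
  have hs₁ := hrep.strictMono₁
  have hconst : ∀ d, V (constPlan S d) = lifetimeUtility u β d := by
    have hstep : ∀ d : ℕ → ProbabilityMeasure C,
        V (constPlan S d) = u (d 0) + β * V (constPlan S fun t => d (t + 1)) := by
      intro d
      have h := hVrec (constPlan S d) (fun _ => Classical.arbitrary S)
      have hm := hVmem (constPlan S fun t => d (t + 1))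
      have e : (fun s => V ((constPlan S d).continuation s)) =
          fun _ : S => V (constPlan S fun t => d (t + 1)) := rfl
      rw [hK] at hc₁ hs₁ hm h
      rw [e, smoothFunctional_const μ₁ hc₁ hs₁ hm] at h
      exact h
    -- `V` and lifetime utility satisfy the same recursion on deterministic plans and both lie in an
    -- interval of length `B`; each unrolled period shrinks their distance by the factor `β`.
    set B := M / (1 - β) - m / (1 - β) with hB
    have hbound : ∀ n : ℕ, ∀ d : ℕ → ProbabilityMeasure C,
        |V (constPlan S d) - lifetimeUtility u β d| ≤ β ^ n * B := by
      intro n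
      induction n with
      | zero =>
        intro d
        have h1 := hVmem (constPlan S d)
        have h2 : lifetimeUtility u β d ∈ utilityRange u β := mem_range_self d
        rw [hK] at h1 h2
        rw [pow_zero, one_mul, abs_le]
        exact ⟨by linarith [h1.1, h2.2], by linarith [h1.2, h2.1]⟩
      | succ n ih =>
        intro d
        rw [hstep d, lifetimeUtility_eq_add hβ hu' d, add_sub_add_left_eq_sub, ← mul_sub, abs_mul,
          abs_of_pos hβ.1, pow_succ', mul_assoc]
        exact mul_le_mul_of_nonneg_left (ih _) hβ.1.le
    intro d
    have hlim : Tendsto (fun n : ℕ => β ^ n * B) atTop (𝓝 0) := by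
      simpa using (tendsto_pow_atTop_nhds_zero_of_lt_one hβ.1.le hβ.2).mul_const B
    have := ge_of_tendsto' hlim fun n => hbound n d
    linarith [abs_nonpos_iff.1 this]
  refine ⟨V, fun h => ?_, hVrec, hconst⟩
  -- Since `V h` is the lifetime utility of some deterministic `d`, the plan `h` is indifferent to
  -- `d`, and the ex-ante functional must assign it that same number.
  obtain ⟨d, hd⟩ := hVmem h
  have hVd : V (constPlan S d) = V h := (hconst d).trans hd
  have h1 := (hrep.exAnte h (constPlan S d)).1 ((hV _ _).2 hVd.le)
  have h2 := (hrep.exAnte (constPlan S d) h).1 ((hV _ _).2 hVd.ge)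
  refine Eq.trans ?_ (le_antisymm h1 h2)
  have e : (constPlan S d : Plan S C).utility u β = fun _ => lifetimeUtility u β d := rfl
  have hm := hVmem h
  rw [← hd] at hm ⊢
  simp only [e]
  rw [hK] at hc₀ hs₀ hm ⊢
  exact (smoothFunctional_const μ₀ hc₀ hs₀ hm).symm

/-- A change of present consumption shifts the ex-ante functional. -/
theorem SmoothRepresentations.smoothFunctional_update_zero [Nonempty S]
    (hrep : SmoothRepresentations pref φ₀ φ₁ u β μ₀ μ₁) (hu : range u = Icc m M)
    {t : ℕ} (ht : 1 ≤ t) {E : Set (ℕ → S)} (hE : MeasurableSet[info S t] E)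
    {d₁ d₂ : ℕ → ProbabilityMeasure C} (hd : ∀ j < t, d₁ j = d₂ j) (x : ProbabilityMeasure C) :
    smoothFunctional (utilityRange u β) φ₀ μ₀
      (binaryAct E (lifetimeUtility u β d₁ + (u x - u (d₁ 0)))
        (lifetimeUtility u β d₂ + (u x - u (d₁ 0)))) =
      smoothFunctional (utilityRange u β) φ₀ μ₀
        (binaryAct E (lifetimeUtility u β d₁) (lifetimeUtility u β d₂)) + (u x - u (d₁ 0)) := by
  have hβ := hrep.beta_mem
  have hu' : ∀ x, u x ∈ Icc m M := fun x => hu ▸ mem_range_self x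
  obtain ⟨V, hV, hrec, -⟩ := hrep.exists_common_value hu
  have h0 : d₁ 0 = d₂ 0 := hd 0 (by omega)
  have hd' : ∀ j < t, Function.update d₁ 0 x j = Function.update d₂ 0 x j := by
    intro j hj
    rcases eq_or_ne j 0 with rfl | h
    · simp
    · rw [Function.update_of_ne h, Function.update_of_ne h, hd j hj]
  have h1 := hV (binaryPlan t E hE d₁ d₂ hd)
  have h2 := hV (binaryPlan t E hE _ _ hd')
  rw [utility_binaryPlan] at h1 h2
  rw [lifetimeUtility_update hβ hu', lifetimeUtility_update hβ hu', pow_zero, one_mul, one_mul,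
    ← h0] at h2
  have r1 := hrec (binaryPlan t E hE d₁ d₂ hd) (fun _ => Classical.arbitrary S)
  have r2 := hrec (binaryPlan t E hE _ _ hd') (fun _ => Classical.arbitrary S)
  -- Continuations do not see period zero, so the two recursive values differ only in present
  -- utility.
  have hcont : ∀ s, (binaryPlan t E hE _ _ hd').continuation s =
      (binaryPlan t E hE d₁ d₂ hd).continuation s := fun s => Plan.ext_toFun <| by
    funext j ω
    simp [Plan.continuation, binaryPlan]
  have e1 : (binaryPlan t E hE d₁ d₂ hd).toFun 0 (fun _ => Classical.arbitrary S) = d₁ 0 := by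
    simp [binaryPlan, ← h0]
  have e2 : (binaryPlan t E hE _ _ hd').toFun 0 (fun _ => Classical.arbitrary S) = x := by
    simp [binaryPlan]
  simp only [hcont] at r2
  rw [e1] at r1
  rw [e2] at r2
  rw [← h1, ← h2]
  linarith

/-- The ex-ante evaluation of the acts which depend on the first state only. -/
theorem SmoothRepresentations.smoothFunctional_first [Nonempty S]
    (hrep : SmoothRepresentations pref φ₀ φ₁ u β μ₀ μ₁) (hu : range u = Icc m M)
    {A : Set S} (hA : MeasurableSet A) {c x y : ℝ} (hc : c ∈ Icc m M)
    (hx : x ∈ utilityRange u β) (hy : y ∈ utilityRange u β) :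
    smoothFunctional (utilityRange u β) φ₀ μ₀
      (binaryAct {ω | ω 0 ∈ A} (c + β * x) (c + β * y)) =
      c + β * smoothFunctional (utilityRange u β) φ₁ μ₁ (binaryAct A x y) := by
  have hβ := hrep.beta_mem
  have hu' : ∀ x, u x ∈ Icc m M := fun x => hu ▸ mem_range_self x
  obtain ⟨V, hV, hrec, hconst⟩ := hrep.exists_common_value hu
  obtain ⟨l, rfl⟩ : c ∈ range u := hu ▸ hc
  obtain ⟨d₁, rfl⟩ := hx
  obtain ⟨d₂, rfl⟩ := hy
  have hE := measurableSet_info_first hA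
  -- The streams delayed by one period, with the common lottery `l` consumed first.
  let e₁ : ℕ → ProbabilityMeasure C := fun j => Nat.casesOn j l d₁
  let e₂ : ℕ → ProbabilityMeasure C := fun j => Nat.casesOn j l d₂
  have he : ∀ j < 1, e₁ j = e₂ j := by
    intro j hj
    obtain rfl : j = 0 := by omega
    rfl
  have h1 := hV (binaryPlan 1 _ hE e₁ e₂ he)
  rw [utility_binaryPlan, lifetimeUtility_eq_add hβ hu' e₁, lifetimeUtility_eq_add hβ hu' e₂] at h1
  refine h1.symm.trans ?_
  have r1 := hrec (binaryPlan 1 _ hE e₁ e₂ he) (fun _ => Classical.arbitrary S)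
  have z1 : (binaryPlan 1 _ hE e₁ e₂ he).toFun 0 (fun _ => Classical.arbitrary S) = l := by
    simp only [binaryPlan, ← he 0 one_pos, ite_self]
    rfl
  have z2 : (fun s => V ((binaryPlan 1 _ hE e₁ e₂ he).continuation s)) =
      binaryAct A (lifetimeUtility u β d₁) (lifetimeUtility u β d₂) := by
    funext s
    have hs := continuation_binaryPlan_first A hE e₁ e₂ he s
    by_cases h : s ∈ A
    · rw [hs.1 h, binaryAct_of_mem h, hconst]
    · rw [hs.2 h, binaryAct_of_notMem h, hconst]
  rw [z1, z2] at r1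
  exact r1

/-- The payoff `m + β * (z + τ)` is also `(m + β * τ) + β * z`: raising every continuation by `τ` is
worth `β * τ` of present utility, which is available because `β * τ ≤ τ < M - m`. -/
theorem SmoothRepresentations.locallyTranslationInvariant_one [Nonempty S]
    (hrep : SmoothRepresentations pref φ₀ φ₁ u β μ₀ μ₁) (hu : range u = Icc m M) (hmM : m < M)
    {A : Set S} (hA : MeasurableSet A) :
    LocallyTranslationInvariant (smoothFunctional (utilityRange u β) φ₁ μ₁)
      (m / (1 - β)) (M / (1 - β)) (M - m) A := by
  have hβ := hrep.beta_mem
  have hK := utilityRange_eq_Icc hβ hu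
  intro τ hτ hτr v hv
  refine ⟨1, one_pos, fun x hx y hy hax hyb => ?_⟩
  have hβτ : β * τ ≤ τ := by nlinarith [hβ.2]
  have hβτ0 : 0 < β * τ := mul_pos hβ.1 hτ
  have mem : ∀ z, m / (1 - β) ≤ z → z ≤ M / (1 - β) → z ∈ utilityRange u β :=
    fun z h1 h2 => hK ▸ ⟨h1, h2⟩
  have h1 := hrep.smoothFunctional_first hu hA (c := m) (x := x + τ) (y := y + τ)
    ⟨le_rfl, hmM.le⟩ (mem _ (by linarith) (by linarith [hx.2, hv.2]))
    (mem _ (by linarith [hy.1, hv.1]) hyb)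
  have h2 := hrep.smoothFunctional_first hu hA (c := m + β * τ) (x := x) (y := y)
    ⟨by linarith, by linarith⟩ (mem _ hax (by linarith [hx.2, hv.2]))
    (mem _ (by linarith [hy.1, hv.1]) (by linarith))
  have e : ∀ z : ℝ, m + β * (z + τ) = m + β * τ + β * z := fun z => by ring
  rw [e, e, h2] at h1
  refine mul_left_cancel₀ hβ.1.ne' ?_
  linarith

/-- Payoffs near `v` are generated by streams that differ only in period `t`, when `E` is known.
Their common present consumption leaves room for `τ` more utils, so the shift is a change of period
zero. -/
theorem SmoothRepresentations.locallyTranslationInvariant_zero [Nonempty S]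
    (hrep : SmoothRepresentations pref φ₀ φ₁ u β μ₀ μ₁) (hu : range u = Icc m M)
    {t : ℕ} (ht : 1 ≤ t) {E : Set (ℕ → S)} (hE : MeasurableSet[info S t] E) :
    LocallyTranslationInvariant (smoothFunctional (utilityRange u β) φ₀ μ₀)
      (m / (1 - β)) (M / (1 - β)) (M - m) E := by
  have hβ := hrep.beta_mem
  have hu' : ∀ x, u x ∈ Icc m M := fun x => hu ▸ mem_range_self x
  have h1β : 0 < 1 - β := sub_pos.2 hβ.2
  intro τ hτ hτr v hv
  set a := m / (1 - β) with ha
  set b := M / (1 - β) with hb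
  have ha' : (1 - β) * a = m := by rw [ha]; field_simp
  have hb' : (1 - β) * b = M := by rw [hb]; field_simp
  -- the payoff `v` as the utility of a stream which is constant from period one on
  have hden : 0 < b - τ - a := by linarith [hv.1, hv.2]
  set ρ := (v - a) / (b - τ - a) with hρ
  have hρ0 : 0 < ρ := div_pos (by linarith [hv.1]) hden
  have hρ1 : ρ < 1 := (div_lt_one hden).2 (by linarith [hv.2])
  have hρv : ρ * (b - τ - a) = v - a := by rw [hρ]; field_simp
  -- Present utility and continuation are placed at the same relative position `ρ` in `[m, M - τ]`
  -- and `[a, b]`. Thus `c + τ` is still feasible, and the later per-period utility `(1 - β) * k` is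
  -- interior.
  set c := m + ρ * (M - τ - m) with hc
  set k := a + ρ * (b - a) with hk
  have hck : c + β * k = v := by
    rw [hc, hk]
    linear_combination hρv - (1 - ρ) * ha' - ρ * hb'
  have hτM : 0 < M - τ - m := by linarith
  have hc1 : m ≤ c := by nlinarith
  have hc2 : c + τ ≤ M := by nlinarith
  have hkm : (1 - β) * k = m + ρ * (M - m) := by
    rw [hk]; linear_combination (1 - ρ) * ha' + ρ * hb'
  have hMm : 0 < M - m := by linarith
  have hk1 : m < (1 - β) * k := by nlinarith
  have hk2 : (1 - β) * k < M := by nlinarith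
  obtain ⟨lc, hlc⟩ : c ∈ range u := hu ▸ ⟨hc1, by linarith⟩
  obtain ⟨lc', hlc'⟩ : c + τ ∈ range u := hu ▸ ⟨by linarith, hc2⟩
  obtain ⟨lk, hlk⟩ : (1 - β) * k ∈ range u := hu ▸ ⟨hk1.le, hk2.le⟩
  let d : ℕ → ProbabilityMeasure C := Function.update (fun _ => lk) 0 lc
  have hdv : lifetimeUtility u β d = v := by
    rw [lifetimeUtility_update hβ hu', lifetimeUtility_const hβ, hlc, hlk, ← hck]
    field_simp
    ring
  have ht0 : t ≠ 0 := by omega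
  have hdt : d t = lk := Function.update_of_ne ht0 _ _
  have hd0 : d 0 = lc := Function.update_self ..
  have hβt : 0 < β ^ t := pow_pos hβ.1 t
  -- The discounted room, upwards and downwards, for changing the utility of period `t` alone.
  refine ⟨β ^ t * min ((1 - β) * k - m) (M - (1 - β) * k),
    mul_pos hβt (lt_min (by linarith) (by linarith)), fun x hx y hy hax hyb => ?_⟩
  have hmin1 : β ^ t * min ((1 - β) * k - m) (M - (1 - β) * k) ≤ β ^ t * ((1 - β) * k - m) :=
    mul_le_mul_of_nonneg_left (min_le_left _ _) hβt.le
  have hmin2 : β ^ t * min ((1 - β) * k - m) (M - (1 - β) * k) ≤ β ^ t * (M - (1 - β) * k) :=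
    mul_le_mul_of_nonneg_left (min_le_right _ _) hβt.le
  have hreach : ∀ z, v - β ^ t * ((1 - β) * k - m) ≤ z → z ≤ v + β ^ t * (M - (1 - β) * k) →
      ∃ l, lifetimeUtility u β (Function.update d t l) = z := by
    intro z h1 h2
    have h3 : (z - v) / β ^ t ≤ M - (1 - β) * k := by
      rw [div_le_iff₀ hβt]; linarith
    have h4 : m - (1 - β) * k ≤ (z - v) / β ^ t := by
      rw [le_div_iff₀ hβt]; linarith
    obtain ⟨l, hl⟩ : (1 - β) * k + (z - v) / β ^ t ∈ range u := hu ▸ ⟨by linarith, by linarith⟩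
    refine ⟨l, ?_⟩
    rw [lifetimeUtility_update hβ hu', hdt, hl, hlk, hdv]
    field_simp
    ring
  have hpos1 : 0 ≤ β ^ t * ((1 - β) * k - m) := mul_nonneg hβt.le (by linarith)
  have hpos2 : 0 ≤ β ^ t * (M - (1 - β) * k) := mul_nonneg hβt.le (by linarith)
  obtain ⟨lx, hlx⟩ := hreach x (by linarith [hx.1]) (by linarith [hx.2])
  obtain ⟨ly, hly⟩ := hreach y (by linarith [hy.1]) (by linarith [hy.2])
  have := hrep.smoothFunctional_update_zero hu ht hE
    (d₁ := Function.update d t lx) (d₂ := Function.update d t ly)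
    (fun j hj => by rw [Function.update_of_ne hj.ne, Function.update_of_ne hj.ne]) lc'
  rw [hlx, hly, Function.update_of_ne ht0.symm, hd0, hlc, hlc', add_sub_cancel_left] at this
  exact this

end Representation

end

/-! ### Conclusion: the two cases for `φ₀` -/

theorem corollary3 {S C : Type*}
    [Finite S] [MeasurableSpace S] [DiscreteMeasurableSpace S] (hS : 3 ≤ Nat.card S)
    [TopologicalSpace C] [CompactSpace C] [TopologicalSpace.MetrizableSpace C]
    [MeasurableSpace C] [BorelSpace C] [Nontrivial C]
    (pref : Plan S C → Plan S C → Prop) (φ₀ φ₁ : ℝ → ℝ)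
    (u : ProbabilityMeasure C → ℝ) (β : ℝ)
    (μ₀ : SecondOrderPrior (ℕ → S)) (μ₁ : SecondOrderPrior S)
    (hrep : SmoothRepresentations pref φ₀ φ₁ u β μ₀ μ₁)
    (hcont : ContinuousFunctional (utilityRange u β)
      (smoothFunctional (utilityRange u β) φ₀ μ₀))
    (hid₀ : IsIdentified (utilityRange u β) φ₀ μ₀)
    (hid₁ : IsIdentified (utilityRange u β) φ₁ μ₁) :
    (∃ θ₀ a b : ℝ, 0 ≤ θ₀ ∧ 0 < a ∧ ∀ t ∈ utilityRange u β, φ₀ t = a * caraExp θ₀ t + b) ∧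
    (∃ θ₁ a b : ℝ, 0 ≤ θ₁ ∧ 0 < a ∧ ∀ t ∈ utilityRange u β, φ₁ t = a * caraExp θ₁ t + b) := by
  have hne : Nonempty S := (Nat.card_pos_iff.1 (by omega)).1
  obtain ⟨m, M, hmM, hu⟩ := exists_range_eq_Icc hrep.u_continuous hrep.u_affine hrep.u_nonconstant
  have hβ := hrep.beta_mem
  have hK := utilityRange_eq_Icc hβ hu
  have hab : m / (1 - β) < M / (1 - β) := div_lt_div_of_pos_right hmM (sub_pos.2 hβ.2)
  have hr : 0 < M - m := sub_pos.2 hmM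
  have hφ₀ := hrep.continuous₀
  have hφ₁ := hrep.continuous₁
  have hs₀ := hrep.strictMono₀
  have hs₁ := hrep.strictMono₁
  have hv₀ := hrep.concave₀
  have hv₁ := hrep.concave₁
  have hT₀ := fun (t : ℕ) (ht : 1 ≤ t) (E : Set (ℕ → S)) (hE : MeasurableSet[info S t] E) =>
    hrep.locallyTranslationInvariant_zero hu ht hE
  have hT₁ := fun (A : Set S) (hA : MeasurableSet A) =>
    hrep.locallyTranslationInvariant_one hu hmM hA
  rw [hK] at hcont hid₀ hid₁ hφ₀ hφ₁ hs₀ hs₁ hv₀ hv₁ ⊢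
  simp only [hK] at hT₀ hT₁
  refine ⟨?_, exists_caraExp_of_identified μ₁ hab hr hφ₁ hs₁ hv₁ hid₁ hT₁⟩
  -- For `φ₀`, invariance is available only for finite-horizon events, which need not include the
  -- event supplied by identification.
  by_cases hamb : ∃ t, 1 ≤ t ∧ ∃ (E : Set (ℕ → S)) (hE : MeasurableSet[info S t] E),
      ¬ ∃ c : ℝ, ∀ᵐ p ∂μ₀.measure, p.toFun ⟨E, measurableSet_of_info hE⟩ = c
  · obtain ⟨t, ht, E, hE, h⟩ := hamb
    exact exists_caraExp_of_ambiguous μ₀ hab hr hφ₀ hs₀ hv₀ (measurableSet_of_info hE) h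
      (hT₀ t ht E hE)
  · push Not at hamb
    have hconst := ae_const_of_generateFrom μ₀ hab hφ₀ hs₀ hcont
      (G := ⋃ t, {E | MeasurableSet[info S t] E})
      ((MeasurableSpace.generateFrom_iUnion_measurableSet (info S)).trans (iSup_info S)).symm
      (isPiSystem_iUnion_of_monotone _
        (fun t => @MeasurableSpace.isPiSystem_measurableSet _ (info S t))
        (fun s t hst E hE => info_mono S hst E hE))
      (by
        intro E hE hEm
        obtain ⟨t, ht⟩ := mem_iUnion.1 hE
        -- An event of horizon `t` also has horizon `t + 1`, which meets the requirement of at least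
        -- one period.
        exact hamb (t + 1) (by omega) E (info_mono S (Nat.le_succ t) E ht))
    refine exists_caraExp_of_identified μ₀ hab hr hφ₀ hs₀ hv₀ hid₀ fun E hE => ?_
    obtain ⟨c, hc⟩ := hconst E hE
    exact locallyTranslationInvariant_of_ae_const μ₀ hφ₀ hs₀ hE hc
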